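/- All sequences and matrices are real and infinite, indexed by the natural numbers. For a bounded sequence $x$ let $x^*$ be the non-increasing rearrangement of $|x|$. A symmetric sequence space is a nonzero linear space $E$ of bounded sequences with a complete norm $\|\cdot\|_E$ such that (i) if $y\in E$ and $|x|\le|y|$ coordinatewise, then $x\in E$ and $\|x\|_E\le\|y\|_E$; (ii) if $y\in E$ and $x$ is a bounded sequence with $x^*=y^*$, then $x\in E$ and $\|x\|_E=\|y\|_E$. For $1\le p\le\infty$, $E$ is $p$-convex if there is $C>0$ with $$\Big\|\Big(\sum_{k=1}^n|x_k|^p\Big)^{1/p}\Big\|_E\le C\Big(\sum_{k=1}^n\|x_k\|_E^p\Big)^{1/p}$$ for all $n$ and $x_1,\dots,x_n\in E$; for $1\le q\le\infty$, it is $q$-concave if there is $C>0$ with $$\Big(\sum_{k=1}^n\|x_k\|_E^q\Big)^{1/q}\le C\Big\|\Big(\sum_{k=1}^n|x_k|^q\Big)^{1/q}\Big\|_E$$ for all $n$ and $x_1,\dots,x_n\in E$ (with maxima in place of the sums if $p=\infty$ or $q=\infty$). For spaces $E,F$ of this kind let $B(E,F)$ be the set of matrices $A=(a_{ij})$ for which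 $x\mapsto\big(\sum_j a_{ij}x_j\big)_i$ is a well-defined bounded linear operator from $E$ to $F$, and let $\mathcal M(E,F)$, the set of $(E,F)$-Schur multipliers, be the set of matrices $M=(m_{ij})$ such that the Schur product $M*A=(m_{ij}a_{ij})$ belongs to $B(E,F)$ for every $A\in B(E,F)$. **Theorem.** Let $1\le p,q\le\infty$, and let $E$ and $F$ be symmetric sequence spaces. If $E$ is $p$-convex and $F$ is $q$-concave, then $$\mathcal M(E,F)\subseteq\mathcal M(l_p,l_q).$$ -/

import Mathlib

open scoped ENNReal Matrix

/-- A normed space of real sequences: a linear space `carrier` of real sequences (with the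
coordinatewise operations), together with a norm on it. -/
structure NormedSeqSpace where
  carrier : Submodule ℝ (ℕ → ℝ)
  norm : Seminorm ℝ carrier
  eq_zero_of_norm_eq_zero : ∀ x : carrier, norm x = 0 → x = 0

/-- The non-increasing rearrangement `x*` of `|x|`, for a bounded sequence `x`: the number
`x*_n` (`n = 0, 1, 2, …`) is the least `t ≥ 0` such that at most `n` of the `|x_k|` exceed `t`.
If `x` tends to zero, then this is the sequence `|x|` put in non-increasing order. -/
noncomputable def decRearr (x : ℕ → ℝ) (n : ℕ) : ℝ :=
  sInf {t : ℝ | 0 ≤ t ∧ {k : ℕ | t < |x k|}.encard ≤ n}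

namespace NormedSeqSpace

/-- Symmetric sequence spaces: nonzero Banach spaces of bounded real sequences, with a monotone
norm, that are solid and rearrangement invariant. -/
structure IsSymmetric (E : NormedSeqSpace) : Prop where
  bounded : ∀ x : E.carrier, BddAbove (Set.range fun k : ℕ => |(x : ℕ → ℝ) k|)
  nonzero : ∃ x : E.carrier, x ≠ 0
  complete : ∀ u : ℕ → E.carrier,
    (∀ ε : ℝ, 0 < ε → ∃ N : ℕ, ∀ m ≥ N, ∀ n ≥ N, E.norm (u m - u n) < ε) →
    ∃ x : E.carrier, Filter.Tendsto (fun n => E.norm (u n - x)) Filter.atTop (nhds 0)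
  solid : ∀ (y : E.carrier) (x : ℕ → ℝ), (∀ k, |x k| ≤ |(y : ℕ → ℝ) k|) →
    ∃ hx : x ∈ E.carrier, E.norm ⟨x, hx⟩ ≤ E.norm y
  symmetric : ∀ (y : E.carrier) (x : ℕ → ℝ), BddAbove (Set.range fun k : ℕ => |x k|) →
    decRearr x = decRearr y → ∃ hx : x ∈ E.carrier, E.norm ⟨x, hx⟩ = E.norm y

/-- The space `l_p` with its usual norm, `1 ≤ p ≤ ∞`. -/
noncomputable def ell (p : ℝ≥0∞) [Fact (1 ≤ p)] : NormedSeqSpace where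
  carrier :=
    { carrier := {x | Memℓp x p}
      zero_mem' := zero_memℓp
      add_mem' := fun hx hy => hx.add hy
      smul_mem' := fun c _ hx => hx.const_smul c }
  norm := Seminorm.of (fun x => ‖(⟨x.1, x.2⟩ : lp (fun _ : ℕ => ℝ) p)‖)
    (fun x y => norm_add_le (⟨x.1, x.2⟩ : lp (fun _ : ℕ => ℝ) p) ⟨y.1, y.2⟩)
    (fun c x => norm_smul c (⟨x.1, x.2⟩ : lp (fun _ : ℕ => ℝ) p))
  eq_zero_of_norm_eq_zero := fun x hx => by
    have h : (⟨x.1, x.2⟩ : lp (fun _ : ℕ => ℝ) p) = 0 := norm_eq_zero.mp hx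
    exact Subtype.ext (congrArg Subtype.val h)

end NormedSeqSpace

/-- The `l_p` norm `(∑_k |v_k|^p)^(1/p)` of a finite family of real numbers
(`max_k |v_k|` if `p = ∞`). -/
noncomputable def finNorm (p : ℝ≥0∞) {n : ℕ} (v : Fin n → ℝ) : ℝ :=
  ‖(WithLp.toLp p v : PiLp p fun _ : Fin n => ℝ)‖

namespace NormedSeqSpace

/-- `p`-convexity. In a solid space the sequence `(∑_k |x_k|^p)^(1/p)` always belongs to `E`,
since it is dominated by `∑_k |x_k|`. -/
def PConvex (p : ℝ≥0∞) (E : NormedSeqSpace) : Prop :=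
  ∃ C : ℝ, 0 < C ∧ ∀ (n : ℕ) (x : Fin n → E.carrier),
    ∃ h : (fun i : ℕ => finNorm p fun k => (x k : ℕ → ℝ) i) ∈ E.carrier,
      E.norm ⟨_, h⟩ ≤ C * finNorm p fun k => E.norm (x k)

/-- `q`-concavity. In a solid space the sequence `(∑_k |x_k|^q)^(1/q)` always belongs to `E`,
since it is dominated by `∑_k |x_k|`. -/
def QConcave (q : ℝ≥0∞) (E : NormedSeqSpace) : Prop :=
  ∃ C : ℝ, 0 < C ∧ ∀ (n : ℕ) (x : Fin n → E.carrier),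
    ∃ h : (fun i : ℕ => finNorm q fun k => (x k : ℕ → ℝ) i) ∈ E.carrier,
      (finNorm q fun k => E.norm (x k)) ≤ C * E.norm ⟨_, h⟩

/-- `B(E, F)`: the infinite matrices `A` for which `x ↦ (∑_j a_{ij} x_j)_i` is a bounded linear
operator from `E` into `F` (the series being convergent). -/
def boundedMatrices (E F : NormedSeqSpace) : Set (Matrix ℕ ℕ ℝ) :=
  {A | (∀ x : E.carrier, ∀ i : ℕ, Summable fun j : ℕ => A i j * (x : ℕ → ℝ) j) ∧
    ∃ C : ℝ, ∀ x : E.carrier,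
      ∃ h : (fun i : ℕ => ∑' j : ℕ, A i j * (x : ℕ → ℝ) j) ∈ F.carrier,
        F.norm ⟨_, h⟩ ≤ C * E.norm x}

/-- `𝓜(E, F)`: the infinite matrices `M` such that the Schur (entrywise) product of `M` with
every `A` in `B(E, F)` is again in `B(E, F)`. -/
def multipliers (E F : NormedSeqSpace) : Set (Matrix ℕ ℕ ℝ) :=
  {M | ∀ A ∈ boundedMatrices E F, Matrix.hadamard M A ∈ boundedMatrices E F}

end NormedSeqSpace

/-! A Schur product lets diagonal factors pass through it. If `x = d e` and `y = g f`
coordinatewise, then ⟨y, (M*A)x⟩ = ⟨f, (M*(D_g A D_d)) e⟩, where D_g and D_d are the diagonal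
matrices of g and d. So, given A bounded from ℓ_p to ℓ_q and finite x, y, it suffices to choose the
factors so that D_d : E → ℓ_p and D_g : ℓ_q → F are contractions, while e has norm at most C‖x‖_p in
E and f has norm at most C'‖y‖_{q'} in the dual of F. Then D_g A D_d is bounded from E to F with the
constant of A, and a uniform bound for the multiplier M gives |⟨y, (M*A)x⟩| ≤ K C C' c ‖x‖_p
‖y‖_{q'}, with c the constant of A. This does not depend on the size of the section, so M*A is
bounded from ℓ_p to ℓ_q.

The factorization (`exists_factorization`) is a variational argument of Lozanovskii type. For p < ∞
and ‖x‖_p = 1, maximize ∏ u_i^{|x_i|^p} over the closed convex hull of the p-th powers |z|^p of the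
unit ball. By p-convexity `e = u^(1/p)` has norm at most C, and the first-order condition at the
maximum says exactly that D_{x/e} is a contraction into ℓ_p. On the side of F, q-concavity dualizes
to q'-convexity (`isPConvexWith_dual`), and the factorization for the dual norm is transposed
(`exists_dual_factorization`).

The uniform bound (`exists_multiplier_bound`) comes from Banach–Steinhaus on ℓ₁. If contractions A_k
violated it, the combinations Σ t_k A_k with t in ℓ₁ would still lie in B(E, F), by completeness of
F, and M maps each of them into B(E, F). -/

section FinNorm

/-! ### Finite ℓ_p norms and Hölder duality -/

variable {p q : ℝ≥0∞} {n : ℕ}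

lemma finNorm_of_ne_top [Fact (1 ≤ p)] (hp : p ≠ ∞) (v : Fin n → ℝ) :
    finNorm p v = (∑ i, |v i| ^ p.toReal) ^ (1 / p.toReal) := by
  have h0 : 0 < p.toReal := ENNReal.toReal_pos (zero_lt_one.trans_le Fact.out).ne' hp
  rw [finNorm, PiLp.norm_eq_sum h0]
  simp [Real.norm_eq_abs]

lemma finNorm_rpow [Fact (1 ≤ p)] (hp : p ≠ ∞) (v : Fin n → ℝ) :
    finNorm p v ^ p.toReal = ∑ i, |v i| ^ p.toReal := by
  have h0 : 0 < p.toReal := ENNReal.toReal_pos (zero_lt_one.trans_le Fact.out).ne' hp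
  rw [finNorm_of_ne_top hp, ← Real.rpow_mul (by positivity), one_div_mul_cancel h0.ne',
    Real.rpow_one]

lemma finNorm_one (v : Fin n → ℝ) : finNorm 1 v = ∑ i, |v i| := by
  rw [finNorm, PiLp.norm_eq_of_L1]; simp [Real.norm_eq_abs]

lemma finNorm_nonneg [Fact (1 ≤ p)] (v : Fin n → ℝ) : 0 ≤ finNorm p v := norm_nonneg _

lemma abs_le_finNorm [Fact (1 ≤ p)] (v : Fin n → ℝ) (i : Fin n) : |v i| ≤ finNorm p v :=
  PiLp.norm_apply_le (WithLp.toLp p v) i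

lemma finNorm_top_le {v : Fin n → ℝ} {c : ℝ} (hc : 0 ≤ c) (h : ∀ i, |v i| ≤ c) :
    finNorm ∞ v ≤ c := by
  rw [finNorm, PiLp.norm_eq_ciSup]
  exact Real.iSup_le h hc

lemma finNorm_mono [Fact (1 ≤ p)] {v w : Fin n → ℝ} (h : ∀ i, |v i| ≤ |w i|) :
    finNorm p v ≤ finNorm p w := by
  by_cases hp : p = ∞
  · subst hp
    exact finNorm_top_le (finNorm_nonneg w) fun i => (h i).trans (abs_le_finNorm w i)
  · rw [finNorm_of_ne_top hp, finNorm_of_ne_top hp]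
    exact Real.rpow_le_rpow (by positivity) (Finset.sum_le_sum fun i _ =>
      Real.rpow_le_rpow (abs_nonneg _) (h i) ENNReal.toReal_nonneg) (by positivity)

lemma finNorm_smul [Fact (1 ≤ p)] (c : ℝ) (v : Fin n → ℝ) :
    finNorm p (c • v) = |c| * finNorm p v := by
  rw [finNorm, WithLp.toLp_smul, norm_smul, Real.norm_eq_abs, finNorm]

lemma finNorm_zero [Fact (1 ≤ p)] : finNorm p (0 : Fin n → ℝ) = 0 := by
  simp [finNorm]

lemma finNorm_eq_zero [Fact (1 ≤ p)] {v : Fin n → ℝ} : finNorm p v = 0 ↔ v = 0 := by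
  simp [finNorm]

lemma finNorm_single [Fact (1 ≤ p)] (i : Fin n) (c : ℝ) :
    finNorm p (Pi.single i c) = |c| := by
  exact PiLp.norm_single p (fun _ : Fin n => ℝ) i c

lemma continuous_finNorm [Fact (1 ≤ p)] : Continuous (finNorm p : (Fin n → ℝ) → ℝ) :=
  continuous_norm.comp (PiLp.continuous_toLp p _)

lemma toReal_holderConjugate [p.HolderConjugate q] (hp : p ≠ 1) (hp' : p ≠ ∞) :
    p.toReal.HolderConjugate q.toReal := by
  have h := ENNReal.HolderConjugate.inv_add_inv_eq_one p q
  have hp0 : p ≠ 0 := fun h0 => by simp [h0] at h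
  have hq0 : q ≠ 0 := fun h0 => by simp [h0] at h
  have hq' : q ≠ ∞ := fun h0 => by simp [h0] at h; exact hp h
  refine Real.holderConjugate_iff.2 ⟨?_, ?_⟩
  · have h1 : 1 ≤ p := ENNReal.HolderConjugate.one_le p q
    rw [← ENNReal.toReal_one]
    exact (ENNReal.toReal_lt_toReal ENNReal.one_ne_top hp').2 (lt_of_le_of_ne h1 hp.symm)
  · rw [← ENNReal.toReal_inv, ← ENNReal.toReal_inv, ← ENNReal.toReal_add, h, ENNReal.toReal_one]
    · exact ENNReal.inv_ne_top.2 hp0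
    · exact ENNReal.inv_ne_top.2 hq0

lemma abs_sum_mul_le_finNorm [Fact (1 ≤ p)] [Fact (1 ≤ q)] [p.HolderConjugate q]
    (v w : Fin n → ℝ) : |∑ i, v i * w i| ≤ finNorm p v * finNorm q w := by
  have key : ∀ v w : Fin n → ℝ, |∑ i, v i * w i| ≤ finNorm 1 v * finNorm ∞ w := by
    intro v w
    rw [finNorm_one, Finset.sum_mul]
    refine (Finset.abs_sum_le_sum_abs _ _).trans (Finset.sum_le_sum fun i _ => ?_)
    rw [abs_mul]
    exact mul_le_mul_of_nonneg_left (abs_le_finNorm w i) (abs_nonneg _)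
  by_cases h1 : p = 1
  · subst h1
    obtain rfl : q = ∞ := ENNReal.HolderConjugate.unique 1 q ∞
    exact key v w
  by_cases h2 : p = ∞
  · subst h2
    obtain rfl : q = 1 := ENNReal.HolderConjugate.unique ∞ q 1
    rw [mul_comm]
    simpa only [mul_comm] using key w v
  have hpq := toReal_holderConjugate (q := q) h1 h2
  have hq : q ≠ ∞ := fun h => by have := hpq.symm.pos; simp [h] at this
  rw [finNorm_of_ne_top h2, finNorm_of_ne_top hq]
  refine (Finset.abs_sum_le_sum_abs _ _).trans ?_
  simp only [abs_mul]
  simpa using Real.inner_le_Lp_mul_Lq Finset.univ (fun i => |v i|) (fun i => |w i|) hpq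

/-- Hölder's inequality is attained: by the signs of v if p = 1, by a signed unit vector at a
largest coordinate if p = ∞, and otherwise by the signs of v times the nonnegative extremal vector
for |v|. -/
lemma exists_sum_mul_eq_finNorm [Fact (1 ≤ p)] [Fact (1 ≤ q)] [p.HolderConjugate q]
    (v : Fin n → ℝ) : ∃ w : Fin n → ℝ, finNorm q w ≤ 1 ∧ ∑ i, v i * w i = finNorm p v := by
  by_cases h1 : p = 1
  · subst h1
    obtain rfl : q = ∞ := ENNReal.HolderConjugate.unique 1 q ∞
    refine ⟨fun i => SignType.sign (v i), finNorm_top_le zero_le_one fun i => ?_, ?_⟩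
    · rcases lt_trichotomy (v i) 0 with h | h | h <;> simp [h]
    · simp [finNorm_one]
  by_cases h2 : p = ∞
  · subst h2
    obtain rfl : q = 1 := ENNReal.HolderConjugate.unique ∞ q 1
    rcases isEmpty_or_nonempty (Fin n) with hn | hn
    · exact ⟨0, by simp [finNorm_zero], by simp [Subsingleton.elim v 0, finNorm_zero]⟩
    obtain ⟨i, hi⟩ := Finite.exists_max fun i => |v i|
    refine ⟨Pi.single i (SignType.sign (v i)), ?_, ?_⟩
    · rw [finNorm_single]
      rcases lt_trichotomy (v i) 0 with h | h | h <;> simp [h]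
    · rw [Finset.sum_eq_single i (fun j _ hj => by simp [hj]) (by simp)]
      rw [Pi.single_eq_same, self_mul_sign]
      exact le_antisymm (abs_le_finNorm v i) (finNorm_top_le (abs_nonneg _) hi)
  have hpq := toReal_holderConjugate (q := q) h1 h2
  have hq : q ≠ ∞ := fun h => by have := hpq.symm.pos; simp [h] at this
  obtain ⟨g, hg, hgs⟩ := (NNReal.isGreatest_Lp Finset.univ (fun i => Real.nnabs (v i)) hpq).1
  refine ⟨fun i => SignType.sign (v i) * (g i : ℝ), ?_, ?_⟩
  · have hg' : ∑ i, (g i : ℝ) ^ q.toReal ≤ 1 := by exact_mod_cast hg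
    calc finNorm q (fun i => SignType.sign (v i) * (g i : ℝ)) ≤ finNorm q fun i => (g i : ℝ) := by
          refine finNorm_mono fun i => ?_
          rw [abs_mul]
          rcases lt_trichotomy (v i) 0 with h | h | h <;> simp [h]
      _ ≤ 1 := by
          rw [finNorm_of_ne_top hq]
          refine Real.rpow_le_one (by positivity) (by simpa using hg') (by positivity)
  · have := congrArg NNReal.toReal hgs
    rw [finNorm_of_ne_top h2]
    simp only [← mul_assoc, self_mul_sign]
    simpa using this

end FinNorm

/-! ### Lattice norms on ℝⁿ and Lozanovskii factorization -/

/-- A lattice norm on `ℝⁿ`, given as a seminorm: it is monotone in absolute values and positive on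
the unit vectors. -/
structure IsLatticeNorm {n : ℕ} (N : Seminorm ℝ (Fin n → ℝ)) : Prop where
  mono : ∀ x y : Fin n → ℝ, (∀ i, |x i| ≤ |y i|) → N x ≤ N y
  single_pos : ∀ i, 0 < N (Pi.single i 1)

/-- `p`-convexity with constant `C` of a seminorm on `ℝⁿ`. -/
def IsPConvexWith (p : ℝ≥0∞) (C : ℝ) {n : ℕ} (N : Seminorm ℝ (Fin n → ℝ)) : Prop :=
  ∀ (m : ℕ) (z : Fin m → Fin n → ℝ),
    N (fun i => finNorm p fun k => z k i) ≤ C * finNorm p fun k => N (z k)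

/-- `q`-concavity with constant `C` of a seminorm on `ℝⁿ`. -/
def IsQConcaveWith (q : ℝ≥0∞) (C : ℝ) {n : ℕ} (N : Seminorm ℝ (Fin n → ℝ)) : Prop :=
  ∀ (m : ℕ) (z : Fin m → Fin n → ℝ),
    (finNorm q fun k => N (z k)) ≤ C * N (fun i => finNorm q fun k => z k i)

namespace IsLatticeNorm

variable {p : ℝ≥0∞} {n : ℕ} {N : Seminorm ℝ (Fin n → ℝ)} {C : ℝ}

lemma single (N : Seminorm ℝ (Fin n → ℝ)) (i : Fin n) (c : ℝ) :
    N (Pi.single i c) = |c| * N (Pi.single i 1) := by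
  have : (Pi.single i c : Fin n → ℝ) = c • Pi.single i 1 := by
    rw [← Pi.single_smul, smul_eq_mul, mul_one]
  rw [this, map_smul_eq_mul, Real.norm_eq_abs]

lemma abs_mul_le (hN : IsLatticeNorm N) (z : Fin n → ℝ) (i : Fin n) :
    |z i| * N (Pi.single i 1) ≤ N z := by
  rw [← single]
  refine hN.mono _ _ fun j => ?_
  rcases eq_or_ne j i with rfl | h
  · simp
  · simp [h]

lemma abs_le (hN : IsLatticeNorm N) (z : Fin n → ℝ) (i : Fin n) :
    |z i| ≤ N z / N (Pi.single i 1) :=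
  (le_div_iff₀ (hN.single_pos i)).2 (hN.abs_mul_le z i)

lemma continuous (N : Seminorm ℝ (Fin n → ℝ)) : Continuous N := by
  let c : NNReal := Real.toNNReal (∑ i, N (Pi.single i 1))
  refine Seminorm.continuous_of_le (q := c • normSeminorm ℝ (Fin n → ℝ)) ?_ fun z => ?_
  · exact continuous_norm.const_smul c
  · calc N z = N (∑ i, Pi.single i (z i)) := by rw [Finset.univ_sum_single]
      _ ≤ ∑ i, N (Pi.single i (z i)) := by
          exact Finset.le_sum_of_subadditive N (map_zero N).le (map_add_le_add N) _ _
      _ ≤ ∑ i, N (Pi.single i 1) * ‖z‖ := by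
          refine Finset.sum_le_sum fun i _ => ?_
          rw [single, mul_comm]
          exact mul_le_mul_of_nonneg_left (norm_le_pi_norm z i) (apply_nonneg _ _)
      _ = (c • normSeminorm ℝ (Fin n → ℝ)) z := by
          rw [← Finset.sum_mul]
          have hc : (c : ℝ) = ∑ i, N (Pi.single i 1) := by
            exact Real.coe_toNNReal _ (Finset.sum_nonneg fun i _ => apply_nonneg _ _)
          rw [← hc]
          rfl

/-- Apply p-convexity to the vectors w_k^(1/p) z_k. Their pointwise ℓ_p norm is the 1/p-th power of
the convex combination Σ w_k |z_k|^p, and the right-hand side is at most C because Σ w_k = 1. -/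
lemma convexHull_rpow_bound [Fact (1 ≤ p)] (hp : p ≠ ∞) (hC : 0 ≤ C)
    (hconv : IsPConvexWith p C N) {u : Fin n → ℝ}
    (hu : u ∈ convexHull ℝ {u : Fin n → ℝ | ∃ z, N z ≤ 1 ∧ u = fun i => |z i| ^ p.toReal}) :
    N (fun i => u i ^ (1 / p.toReal)) ≤ C := by
  have h0 : 0 < p.toReal := ENNReal.toReal_pos (zero_lt_one.trans_le Fact.out).ne' hp
  obtain ⟨ι, _, w, a, hw, hw1, ha, rfl⟩ := mem_convexHull_iff_exists_fintype.1 hu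
  choose z hz haz using ha
  let e := Fintype.equivFin ι
  have hpow : ∀ k (t : ℝ), |w k ^ (1 / p.toReal) * t| ^ p.toReal = w k * |t| ^ p.toReal := by
    intro k t
    rw [abs_mul, Real.mul_rpow (abs_nonneg _) (abs_nonneg _),
      abs_of_nonneg (Real.rpow_nonneg (hw k) _), ← Real.rpow_mul (hw k),
      one_div_mul_cancel h0.ne', Real.rpow_one]
  have key := hconv _ (fun k i => w (e.symm k) ^ (1 / p.toReal) * z (e.symm k) i)
  have h1 : (fun i => finNorm p fun k => w (e.symm k) ^ (1 / p.toReal) * z (e.symm k) i)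
      = fun i => (∑ k, w k • a k) i ^ (1 / p.toReal) := by
    funext i
    rw [finNorm_of_ne_top hp]
    congr 1
    simp only [hpow]
    rw [Equiv.sum_comp e.symm fun k => w k * |z k i| ^ p.toReal, Finset.sum_apply]
    simp [haz]
  rw [h1] at key
  refine key.trans (mul_le_of_le_one_right hC ?_)
  rw [finNorm_of_ne_top hp]
  refine Real.rpow_le_one (by positivity) ?_ (by positivity)
  refine le_of_le_of_eq ?_ ((Equiv.sum_comp e.symm w).trans hw1)
  refine Finset.sum_le_sum fun k _ => ?_
  have h2 : N (fun i => w (e.symm k) ^ (1 / p.toReal) * z (e.symm k) i)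
      = w (e.symm k) ^ (1 / p.toReal) * N (z (e.symm k)) := by
    have := map_smul_eq_mul N (w (e.symm k) ^ (1 / p.toReal)) (z (e.symm k))
    rw [Real.norm_of_nonneg (Real.rpow_nonneg (hw _) _)] at this
    exact this
  rw [h2, hpow]
  refine mul_le_of_le_one_right (hw _) ?_
  rw [abs_of_nonneg (apply_nonneg _ _)]
  exact Real.rpow_le_one (apply_nonneg _ _) (hz _) h0.le

end IsLatticeNorm

/-- At a point `u` of a convex set maximizing `∏ uᵢ ^ wᵢ`, the first-order condition. -/
lemma sum_div_le_of_prod_rpow_max {n : ℕ} {K : Set (Fin n → ℝ)} (hK : Convex ℝ K)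
    (hK0 : ∀ v ∈ K, ∀ i, 0 ≤ v i) {w u v : Fin n → ℝ} (hw : ∀ i, 0 ≤ w i) (hu : u ∈ K)
    (hpos : ∀ i, w i ≠ 0 → 0 < u i)
    (hmax : ∀ v ∈ K, ∏ i, v i ^ w i ≤ ∏ i, u i ^ w i) (hv : v ∈ K) :
    ∑ i, w i / u i * v i ≤ ∑ i, w i := by
  -- Relative increments: where w i ≠ 0, the point (1 - t)u + tv has coordinates u i (1 + t a i).
  set a : Fin n → ℝ := fun i => v i / u i - 1 with ha
  have ha1 : ∀ i, -1 ≤ a i := fun i => by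
    have := div_nonneg (hK0 v hv i) (hK0 u hu i)
    simp only [ha]; linarith
  have hstep : ∀ t : ℝ, 0 < t → t < 1 → ∑ i, w i * (a i / (1 + t * a i)) ≤ 0 := by
    intro t ht ht1
    have hpos1 : ∀ i, 0 < 1 + t * a i := fun i => by nlinarith [ha1 i]
    have h1 := hmax _ (hK hu hv (sub_nonneg.2 ht1.le) ht.le (by ring))
    have hupos : 0 < ∏ i, u i ^ w i := Finset.prod_pos fun i _ => by
      by_cases hwi : w i = 0
      · simp [hwi]
      · exact Real.rpow_pos_of_pos (hpos i hwi) _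
    have h2 : ∏ i, ((1 - t) • u + t • v) i ^ w i
        = (∏ i, (1 + t * a i) ^ w i) * ∏ i, u i ^ w i := by
      rw [← Finset.prod_mul_distrib]
      refine Finset.prod_congr rfl fun i _ => ?_
      by_cases hwi : w i = 0
      · simp [hwi]
      · have hui := hpos i hwi
        rw [← Real.mul_rpow (hpos1 i).le hui.le]
        congr 1
        simp only [ha, Pi.add_apply, Pi.smul_apply, smul_eq_mul]
        field_simp
        ring
    rw [h2] at h1
    have h3 : ∏ i, (1 + t * a i) ^ w i ≤ 1 := by
      by_contra! h
      nlinarith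
    have h4 : ∑ i, w i * Real.log (1 + t * a i) ≤ 0 := by
      have := Real.log_nonpos (Finset.prod_nonneg fun i _ =>
        Real.rpow_nonneg (hpos1 i).le _) h3
      rw [Real.log_prod (fun i _ => (Real.rpow_pos_of_pos (hpos1 i) _).ne')] at this
      simpa only [Real.log_rpow (hpos1 _)] using this
    -- This is log(1 + s) ≥ s/(1 + s) for s = t a i. Dividing by t and letting t → 0+ then yields
    -- the derivative inequality.
    have h5 : ∀ i, t * (a i / (1 + t * a i)) ≤ Real.log (1 + t * a i) := fun i => by
      have := Real.one_sub_inv_le_log_of_pos (hpos1 i)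
      refine le_trans (le_of_eq ?_) this
      field_simp [(hpos1 i).ne']
      ring
    have h6 : t * ∑ i, w i * (a i / (1 + t * a i)) ≤ 0 := by
      rw [Finset.mul_sum]
      refine le_trans (Finset.sum_le_sum fun i _ => ?_) h4
      have := mul_le_mul_of_nonneg_left (h5 i) (hw i)
      linarith
    exact nonpos_of_mul_nonpos_right h6 ht
  have hlim : Filter.Tendsto (fun t : ℝ => ∑ i, w i * (a i / (1 + t * a i)))
      (nhdsWithin 0 (Set.Ioi 0)) (nhds (∑ i, w i * (a i / (1 + 0 * a i)))) := by
    refine tendsto_nhdsWithin_of_tendsto_nhds (ContinuousAt.tendsto ?_)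
    refine tendsto_finsetSum _ fun i _ => ?_
    have : ContinuousAt (fun t : ℝ => w i * (a i / (1 + t * a i))) 0 :=
      ContinuousAt.mul continuousAt_const
        (ContinuousAt.div continuousAt_const (by fun_prop) (by simp))
    exact this
  have hle : ∑ i, w i * (a i / (1 + 0 * a i)) ≤ 0 := by
    refine le_of_tendsto hlim ?_
    filter_upwards [Ioo_mem_nhdsGT (zero_lt_one' ℝ)] with t ht using hstep t ht.1 ht.2
  have : ∑ i, w i / u i * v i = ∑ i, w i * (a i / (1 + 0 * a i)) + ∑ i, w i := by
    rw [← Finset.sum_add_distrib]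
    refine Finset.sum_congr rfl fun i _ => ?_
    simp only [ha]
    ring
  linarith

namespace IsLatticeNorm

variable {p : ℝ≥0∞} {n : ℕ} {N : Seminorm ℝ (Fin n → ℝ)} {C : ℝ}

/-- No extremal problem is needed: the norms of the unit vectors serve as d. The estimate for e is
∞-convexity for the multiples of unit vectors that make up e, the k-th of which has norm |x k|. -/
lemma exists_factorization_top (hN : IsLatticeNorm N) (hC : 0 ≤ C) (hconv : IsPConvexWith ∞ C N)
    (x : Fin n → ℝ) : ∃ d e : Fin n → ℝ, (∀ i, d i * e i = x i) ∧ N e ≤ C * finNorm ∞ x ∧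
      ∀ z : Fin n → ℝ, finNorm ∞ (fun i => d i * z i) ≤ N z := by
  refine ⟨fun i => N (Pi.single i 1), fun i => x i / N (Pi.single i 1),
    fun i => mul_div_cancel₀ _ (hN.single_pos i).ne', ?_, fun z => ?_⟩
  · have h := hconv n fun k => Pi.single k (x k / N (Pi.single k 1))
    refine le_trans (hN.mono _ _ fun i => ?_) (h.trans
      (mul_le_mul_of_nonneg_left (finNorm_mono fun i => ?_) hC))
    · rw [abs_of_nonneg (finNorm_nonneg (p := ∞) _)]
      refine le_trans ?_ (abs_le_finNorm _ i)
      simp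
    · rw [single, abs_div, abs_of_pos (hN.single_pos i), div_mul_cancel₀ _ (hN.single_pos i).ne',
        abs_abs]
  · refine finNorm_top_le (apply_nonneg _ _) fun i => ?_
    rw [abs_mul, abs_of_pos (hN.single_pos i), mul_comm]
    exact hN.abs_mul_le z i

/-- With e = u^(1/p) and d = x/e, the p-th power of ‖dz‖_p is Σ (|x_i|^p / u_i) |z_i|^p.
Contractivity of d is therefore the first-order condition for a maximizer u of ∏ u_i^{|x_i|^p},
tested at the point |z|^p. -/
lemma exists_factorization_of_ne_top [Fact (1 ≤ p)] (hp : p ≠ ∞) (hN : IsLatticeNorm N)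
    (hC : 0 ≤ C) (hconv : IsPConvexWith p C N) (x : Fin n → ℝ) (hx : finNorm p x = 1) :
    ∃ d e : Fin n → ℝ, (∀ i, d i * e i = x i) ∧ N e ≤ C ∧
      ∀ z : Fin n → ℝ, finNorm p (fun i => d i * z i) ≤ N z := by
  have h0 : 0 < p.toReal := ENNReal.toReal_pos (zero_lt_one.trans_le Fact.out).ne' hp
  set r := p.toReal with hr
  set U : Set (Fin n → ℝ) := {u : Fin n → ℝ | ∃ z, N z ≤ 1 ∧ u = fun i => |z i| ^ r} with hU
  set K := closure (convexHull ℝ U) with hKdef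
  -- Positivity on unit vectors bounds every coordinate of the unit ball, so `K` lies in a box and
  -- is compact.
  set b : Fin n → ℝ := fun i => (1 / N (Pi.single i 1)) ^ r with hb
  have hKb : K ⊆ Set.Icc 0 b := by
    refine closure_minimal (convexHull_min ?_ (convex_Icc _ _)) isClosed_Icc
    rintro _ ⟨z, hz, rfl⟩
    refine ⟨fun i => by positivity, fun i => ?_⟩
    exact Real.rpow_le_rpow (abs_nonneg _) ((hN.abs_le z i).trans
      (div_le_div_of_nonneg_right hz (hN.single_pos i).le)) h0.le
  have hKc : IsCompact K := isCompact_Icc.of_isClosed_subset isClosed_closure hKb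
  have hKN : ∀ u ∈ K, N (fun i => u i ^ (1 / r)) ≤ C := by
    have hcl : IsClosed {u : Fin n → ℝ | N (fun i => u i ^ (1 / r)) ≤ C} := by
      refine isClosed_le ((continuous N).comp (continuous_pi fun i => ?_)) continuous_const
      exact (Real.continuous_rpow_const (by positivity)).comp (continuous_apply i)
    exact fun u hu => closure_minimal
      (fun v hv => convexHull_rpow_bound hp hC hconv hv) hcl hu
  have hKconv : Convex ℝ K := (convex_convexHull ℝ U).closure
  set w : Fin n → ℝ := fun i => |x i| ^ r with hwdef
  have hw : ∀ i, 0 ≤ w i := fun i => by positivity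
  have hw1 : ∑ i, w i = 1 := by
    rw [hwdef, hr, ← finNorm_rpow hp, hx, Real.one_rpow]
  have hUK : U ⊆ K := (subset_convexHull ℝ U).trans subset_closure
  -- a strictly positive point of `K`
  obtain ⟨v₀, hv₀, hv₀pos⟩ : ∃ v ∈ K, ∀ i, 0 < v i := by
    set c : ℝ := N (fun _ => 1) + 1 with hc
    have hcpos : 0 < c := by have := apply_nonneg N (fun _ => (1 : ℝ)); linarith
    refine ⟨fun i => |c⁻¹| ^ r, hUK ⟨fun _ => c⁻¹, ?_, rfl⟩, fun i => by positivity⟩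
    have h1 : (fun _ : Fin n => c⁻¹) = c⁻¹ • fun _ => (1 : ℝ) := by ext; simp
    rw [h1, map_smul_eq_mul, Real.norm_of_nonneg (by positivity), inv_mul_le_iff₀ hcpos]
    linarith
  have hcont : Continuous fun v : Fin n → ℝ => ∏ i, v i ^ w i :=
    continuous_finsetProd _ fun i _ =>
      (Real.continuous_rpow_const (hw i)).comp (continuous_apply i)
  obtain ⟨u, huK, humax⟩ := hKc.exists_isMaxOn ⟨v₀, hv₀⟩ hcont.continuousOn
  have hu0 : ∀ i, 0 ≤ u i := (hKb huK).1
  -- A vanishing u i with w i ≠ 0 would make the maximum zero, yet the product is positive at v₀.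
  -- Where w i = 0, u i may vanish, but then x i = 0 and the convention for division by zero is
  -- harmless.
  have hupos : ∀ i, w i ≠ 0 → 0 < u i := by
    intro i hwi
    refine lt_of_le_of_ne (hu0 i) fun h => ?_
    have h1 : 0 < ∏ i, v₀ i ^ w i := Finset.prod_pos fun i _ => Real.rpow_pos_of_pos (hv₀pos i) _
    have h2 : ∏ i, u i ^ w i = 0 :=
      Finset.prod_eq_zero (Finset.mem_univ i) (by rw [← h, Real.zero_rpow hwi])
    have h3 : ∏ i, v₀ i ^ w i ≤ ∏ i, u i ^ w i := humax hv₀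
    linarith
  have hfirst : ∀ v ∈ K, ∑ i, w i / u i * v i ≤ 1 := fun v hv => by
    rw [← hw1]
    exact sum_div_le_of_prod_rpow_max hKconv (fun v hv => (hKb hv).1) hw huK hupos
      (fun v hv => humax hv) hv
  refine ⟨fun i => x i / u i ^ (1 / r), fun i => u i ^ (1 / r), fun i => ?_, hKN u huK,
    fun z => ?_⟩
  · by_cases hwi : w i = 0
    · have : x i = 0 := by
        by_contra h
        exact (Real.rpow_pos_of_pos (abs_pos.2 h) r).ne' hwi
      simp [this]
    · exact div_mul_cancel₀ _ (Real.rpow_pos_of_pos (hupos i hwi) _).ne'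
  · have hmain : ∀ z, N z ≤ 1 → finNorm p (fun i => x i / u i ^ (1 / r) * z i) ≤ 1 := by
      intro z hz
      rw [finNorm_of_ne_top hp]
      refine Real.rpow_le_one (by positivity) ?_ (by positivity)
      refine le_trans (le_of_eq (Finset.sum_congr rfl fun i _ => ?_))
        (hfirst _ (hUK ⟨z, hz, rfl⟩))
      rw [abs_mul, abs_div, abs_of_nonneg (Real.rpow_nonneg (hu0 i) _),
        Real.mul_rpow (div_nonneg (abs_nonneg _) (Real.rpow_nonneg (hu0 i) _))
          (abs_nonneg _), Real.div_rpow (abs_nonneg _)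
        (Real.rpow_nonneg (hu0 i) _), ← Real.rpow_mul (hu0 i), one_div_mul_cancel h0.ne',
        Real.rpow_one]
    rcases (apply_nonneg N z).eq_or_lt with hz | hz
    · have : z = 0 := by
        ext i
        have := hN.abs_le z i
        rw [← hz, zero_div] at this
        simpa using this
      subst this
      rw [← hz]
      exact (finNorm_eq_zero.2 (by ext; simp)).le
    · have h1 := hmain ((N z)⁻¹ • z) (by
        rw [map_smul_eq_mul, Real.norm_of_nonneg (by positivity), inv_mul_cancel₀ hz.ne'])
      have h2 : (fun i => x i / u i ^ (1 / r) * ((N z)⁻¹ • z) i)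
          = (N z)⁻¹ • fun i => x i / u i ^ (1 / r) * z i := by
        ext i; simp only [Pi.smul_apply, smul_eq_mul]; ring
      rw [h2, finNorm_smul, abs_of_pos (by positivity), inv_mul_le_iff₀ hz, mul_one] at h1
      exact h1

/-- Lozanovskii-type factorization through a `p`-convex lattice norm on `ℝⁿ`. -/
lemma exists_factorization [Fact (1 ≤ p)] (hN : IsLatticeNorm N) (hC : 0 ≤ C)
    (hconv : IsPConvexWith p C N) (x : Fin n → ℝ) :
    ∃ d e : Fin n → ℝ, (∀ i, d i * e i = x i) ∧ N e ≤ C * finNorm p x ∧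
      ∀ z : Fin n → ℝ, finNorm p (fun i => d i * z i) ≤ N z := by
  by_cases hp : p = ∞
  · subst hp
    exact hN.exists_factorization_top hC hconv x
  rcases (finNorm_nonneg (p := p) x).eq_or_lt with hx | hx
  · obtain rfl := finNorm_eq_zero.1 hx.symm
    refine ⟨0, 0, by simp, by simp [finNorm_zero], fun z => ?_⟩
    refine le_of_eq_of_le (finNorm_eq_zero.2 ?_) (apply_nonneg _ _)
    ext; simp
  · obtain ⟨d, e, hde, he, hd⟩ := hN.exists_factorization_of_ne_top hp hC hconv
      ((finNorm p x)⁻¹ • x) (by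
        rw [finNorm_smul, abs_of_pos (by positivity), inv_mul_cancel₀ hx.ne'])
    refine ⟨d, finNorm p x • e, fun i => ?_, ?_, hd⟩
    · have := hde i
      simp only [Pi.smul_apply, smul_eq_mul] at this ⊢
      rw [mul_left_comm, this, mul_inv_cancel_left₀ hx.ne']
    · rw [map_smul_eq_mul, Real.norm_of_nonneg hx.le, mul_comm]
      exact mul_le_mul_of_nonneg_right he hx.le

end IsLatticeNorm

/-! ### Dual lattice norms and the concave factorization -/

namespace IsLatticeNorm

variable {p q : ℝ≥0∞} {n : ℕ} {N : Seminorm ℝ (Fin n → ℝ)} {C : ℝ}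

lemma bddAbove_dual (hN : IsLatticeNorm N) (y : Fin n → ℝ) :
    BddAbove (Set.range fun z : {z : Fin n → ℝ // N z ≤ 1} => ∑ i, y i * z.1 i) := by
  refine ⟨∑ i, |y i| * (1 / N (Pi.single i 1)), ?_⟩
  rintro _ ⟨⟨z, hz⟩, rfl⟩
  refine Finset.sum_le_sum fun i _ => (le_abs_self _).trans ?_
  rw [abs_mul]
  exact mul_le_mul_of_nonneg_left ((hN.abs_le z i).trans
    (div_le_div_of_nonneg_right hz (hN.single_pos i).le)) (abs_nonneg _)

/-- Stated for the bare supremum because the homogeneity proof inside `dual` already relies on it.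
-/
lemma sum_le_iSup_mul (hN : IsLatticeNorm N) (y z : Fin n → ℝ) :
    ∑ i, y i * z i ≤ (⨆ z : {z : Fin n → ℝ // N z ≤ 1}, ∑ i, y i * z.1 i) * N z := by
  rcases (apply_nonneg N z).eq_or_lt with hz | hz
  · have : z = 0 := by
      ext i
      have := hN.abs_le z i
      rw [← hz, zero_div] at this
      simpa using this
    simp [this]
  · have h := le_ciSup (hN.bddAbove_dual y) ⟨(N z)⁻¹ • z, by
      rw [map_smul_eq_mul, Real.norm_of_nonneg (by positivity), inv_mul_cancel₀ hz.ne']⟩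
    rw [← div_le_iff₀ hz]
    refine le_trans (le_of_eq ?_) h
    rw [Finset.sum_div]
    refine Finset.sum_congr rfl fun i _ => ?_
    simp only [Pi.smul_apply, smul_eq_mul]
    ring

/-- The dual norm of a lattice norm on `ℝⁿ`, for the standard pairing. -/
noncomputable def dual (hN : IsLatticeNorm N) : Seminorm ℝ (Fin n → ℝ) :=
  haveI : Nonempty {z : Fin n → ℝ // N z ≤ 1} := ⟨⟨0, by simp⟩⟩
  Seminorm.ofSMulLE (fun y => ⨆ z : {z : Fin n → ℝ // N z ≤ 1}, ∑ i, y i * z.1 i)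
    (by simp)
    (fun y y' => ciSup_le fun z => by
      have h : ∑ i, (y + y') i * z.1 i = ∑ i, y i * z.1 i + ∑ i, y' i * z.1 i := by
        simp [add_mul, Finset.sum_add_distrib]
      rw [h]
      exact add_le_add (le_ciSup (hN.bddAbove_dual y) z) (le_ciSup (hN.bddAbove_dual y') z))
    (fun c y => ciSup_le fun z => by
      have h : ∑ i, (c • y) i * z.1 i = ∑ i, y i * (c • z.1) i := by
        refine Finset.sum_congr rfl fun i _ => ?_
        simp only [Pi.smul_apply, smul_eq_mul]
        ring
      rw [h]
      refine (hN.sum_le_iSup_mul y (c • z.1)).trans ?_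
      rw [map_smul_eq_mul, mul_comm]
      refine mul_le_mul_of_nonneg_right (mul_le_of_le_one_right (norm_nonneg _) z.2) ?_
      refine le_trans (le_of_eq ?_) (le_ciSup (hN.bddAbove_dual y) ⟨0, by simp⟩)
      simp)

lemma sum_mul_le_dual (hN : IsLatticeNorm N) (y z : Fin n → ℝ) :
    ∑ i, y i * z i ≤ hN.dual y * N z :=
  hN.sum_le_iSup_mul y z

lemma abs_sum_mul_le_dual (hN : IsLatticeNorm N) (y z : Fin n → ℝ) :
    |∑ i, y i * z i| ≤ hN.dual y * N z := by
  refine abs_le'.2 ⟨hN.sum_mul_le_dual y z, ?_⟩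
  simpa using hN.sum_mul_le_dual y (-z)

lemma dual_le (hN : IsLatticeNorm N) {y : Fin n → ℝ} {c : ℝ}
    (h : ∀ z, N z ≤ 1 → ∑ i, y i * z i ≤ c) : hN.dual y ≤ c := by
  have : Nonempty {z : Fin n → ℝ // N z ≤ 1} := ⟨⟨0, by simp⟩⟩
  exact ciSup_le fun z => h z.1 z.2

lemma isLatticeNorm_dual (hN : IsLatticeNorm N) : IsLatticeNorm hN.dual where
  mono x y hxy := hN.dual_le fun z hz => by
    -- The vector sign(y)|z| stays in the unit ball by monotonicity, and its pairing with y
    -- dominates that of x with z.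
    have h1 : ∑ i, x i * z i ≤ ∑ i, y i * (SignType.sign (y i) * |z i|) := by
      refine Finset.sum_le_sum fun i _ => (le_abs_self _).trans ?_
      rw [abs_mul, ← mul_assoc, self_mul_sign]
      exact mul_le_mul_of_nonneg_right (hxy i) (abs_nonneg _)
    refine h1.trans ((hN.sum_mul_le_dual y _).trans
      (mul_le_of_le_one_right (apply_nonneg _ _) ((hN.mono _ z fun i => ?_).trans hz)))
    rw [abs_mul, abs_abs]
    rcases lt_trichotomy (y i) 0 with h | h | h <;> simp [h]
  single_pos i := by
    have h := hN.sum_mul_le_dual (Pi.single i 1) (Pi.single i 1)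
    rw [Finset.sum_eq_single i (fun j _ hj => by simp [hj]) (by simp)] at h
    simp only [Pi.single_eq_same, mul_one] at h
    exact pos_of_mul_pos_left (zero_lt_one.trans_le h) (apply_nonneg _ _)

/-- Hahn–Banach: the norm of `z` is attained on the dual unit ball. -/
lemma exists_dual_le_one (hN : IsLatticeNorm N) (z : Fin n → ℝ) :
    ∃ y, hN.dual y ≤ 1 ∧ ∑ i, y i * z i = N z := by
  by_cases hz : z = 0
  · exact ⟨0, by simp, by simp [hz]⟩
  obtain ⟨g, hg, hgN⟩ := exists_extension_of_le_sublinear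
    (LinearPMap.mkSpanSingleton z (N z) hz : (Fin n → ℝ) →ₗ.[ℝ] ℝ) N
    (fun c hc x => by rw [map_smul_eq_mul, Real.norm_of_nonneg hc.le]) (map_add_le_add N) (by
      rintro ⟨x, hx⟩
      obtain ⟨c, rfl⟩ := Submodule.mem_span_singleton.1 hx
      rw [LinearPMap.mkSpanSingleton'_apply, map_smul_eq_mul, smul_eq_mul]
      exact mul_le_mul_of_nonneg_right (le_abs_self c) (apply_nonneg _ _))
  have hrep : ∀ x, ∑ i, g (Pi.single i 1) * x i = g x := fun x => by
    conv_rhs => rw [← Finset.univ_sum_single x]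
    rw [map_sum]
    refine Finset.sum_congr rfl fun i _ => ?_
    rw [mul_comm, ← smul_eq_mul, ← map_smul, ← Pi.single_smul, smul_eq_mul, mul_one]
  refine ⟨fun i => g (Pi.single i 1), hN.dual_le fun x hx => ?_, ?_⟩
  · rw [hrep]
    exact (hgN x).trans hx
  · rw [hrep]
    have := hg ⟨z, Submodule.mem_span_singleton_self z⟩
    rw [this]
    exact LinearPMap.mkSpanSingleton_apply ℝ ℝ hz (N z)

/-- For each coordinate i choose a_i in the unit ball of ℓ_q norming (y_k(i))_k. This linearizes the
pointwise ℓ_p norm, so its pairing with z becomes Σ_k ⟨y_k, a(k) z⟩. Hölder in k and q-concavity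
conclude, since the ℓ_q norm of (a_i(k) z_i)_k is at most |z_i|. -/
lemma isPConvexWith_dual [Fact (1 ≤ p)] [Fact (1 ≤ q)] [p.HolderConjugate q]
    (hN : IsLatticeNorm N) (hC : 0 ≤ C) (hconc : IsQConcaveWith q C N) :
    IsPConvexWith p C hN.dual := by
  intro m y
  choose a ha hay using fun i =>
    exists_sum_mul_eq_finNorm (p := p) (q := q) (fun k => y k i)
  refine hN.dual_le fun z hz => ?_
  calc ∑ i, finNorm p (fun k => y k i) * z i
      = ∑ k, ∑ i, y k i * (a i k * z i) := by
        rw [Finset.sum_comm]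
        refine Finset.sum_congr rfl fun i _ => ?_
        rw [← hay, Finset.sum_mul]
        exact Finset.sum_congr rfl fun k _ => mul_assoc _ _ _
    _ ≤ ∑ k, hN.dual (y k) * N (fun i => a i k * z i) :=
        Finset.sum_le_sum fun k _ => hN.sum_mul_le_dual _ _
    _ ≤ finNorm p (fun k => hN.dual (y k)) * finNorm q (fun k => N fun i => a i k * z i) :=
        (le_abs_self _).trans (abs_sum_mul_le_finNorm _ _)
    _ ≤ finNorm p (fun k => hN.dual (y k)) * C := by
        refine mul_le_mul_of_nonneg_left ?_ (finNorm_nonneg _)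
        refine (hconc m _).trans (mul_le_of_le_one_right hC ((hN.mono _ z fun i => ?_).trans hz))
        have h : (fun k => a i k * z i) = z i • a i := by
          ext k; simp [mul_comm]
        rw [h, finNorm_smul, abs_mul, abs_abs, abs_of_nonneg (finNorm_nonneg (p := q) _)]
        exact mul_le_of_le_one_right (abs_nonneg _) (ha i)
    _ = C * finNorm p fun k => hN.dual (y k) := mul_comm _ _

/-- Factorization of the dual of `ℓ_q` through a `q`-concave lattice norm on `ℝⁿ`. -/
lemma exists_dual_factorization [Fact (1 ≤ p)] [Fact (1 ≤ q)] [p.HolderConjugate q]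
    (hN : IsLatticeNorm N) (hC : 0 ≤ C) (hconc : IsQConcaveWith q C N) (y : Fin n → ℝ) :
    ∃ d f : Fin n → ℝ, (∀ i, d i * f i = y i) ∧
      (∀ z, |∑ i, f i * z i| ≤ C * finNorm p y * N z) ∧
      ∀ z : Fin n → ℝ, N (fun i => d i * z i) ≤ finNorm q z := by
  obtain ⟨d, f, hdf, hf, hd⟩ := hN.isLatticeNorm_dual.exists_factorization hC
    (hN.isPConvexWith_dual (p := p) hC hconc) y
  refine ⟨d, f, hdf, fun z => (hN.abs_sum_mul_le_dual f z).trans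
    (mul_le_mul_of_nonneg_right hf (apply_nonneg _ _)), fun z => ?_⟩
  -- Transposition: a diagonal operator is its own adjoint, so being contractive from the dual norm
  -- to ℓ_p makes it contractive from ℓ_q to `N`. This is seen by pairing with a norming g.
  obtain ⟨g, hg, hgz⟩ := hN.exists_dual_le_one fun i => d i * z i
  rw [← hgz]
  calc ∑ i, g i * (d i * z i) = ∑ i, d i * g i * z i :=
        Finset.sum_congr rfl fun i _ => by ring
    _ ≤ finNorm p (fun i => d i * g i) * finNorm q z :=
        (le_abs_self _).trans (abs_sum_mul_le_finNorm _ _)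
    _ ≤ 1 * finNorm q z :=
        mul_le_mul_of_nonneg_right ((hd g).trans hg) (finNorm_nonneg _)
    _ = finNorm q z := one_mul _

end IsLatticeNorm

/-! ### Finite sections of sequences -/

/-- Extension by zero of a finite sequence. -/
def extendZero (n : ℕ) : (Fin n → ℝ) →ₗ[ℝ] (ℕ → ℝ) where
  toFun x i := if h : i < n then x ⟨i, h⟩ else 0
  map_add' x y := by
    ext i
    by_cases h : i < n <;> simp [h]
  map_smul' c x := by
    ext i
    by_cases h : i < n <;> simp [h]

section ExtendZero

variable {n : ℕ}

lemma extendZero_of_lt (x : Fin n → ℝ) {i : ℕ} (h : i < n) : extendZero n x i = x ⟨i, h⟩ :=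
  dif_pos h

lemma extendZero_of_le (x : Fin n → ℝ) {i : ℕ} (h : n ≤ i) : extendZero n x i = 0 :=
  dif_neg h.not_gt

@[simp]
lemma extendZero_val (x : Fin n → ℝ) (i : Fin n) : extendZero n x i = x i :=
  extendZero_of_lt x i.2

lemma abs_extendZero_le {x : Fin n → ℝ} {y : ℕ → ℝ} (h : ∀ i : Fin n, |x i| ≤ |y i|) (i : ℕ) :
    |extendZero n x i| ≤ |y i| := by
  rcases lt_or_ge i n with hi | hi
  · rw [extendZero_of_lt x hi]
    exact h ⟨i, hi⟩
  · rw [extendZero_of_le x hi, abs_zero]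
    exact abs_nonneg _

lemma extendZero_eq_sum (x : Fin n → ℝ) :
    extendZero n x = ∑ i : Fin n, x i • (Pi.single (i : ℕ) 1 : ℕ → ℝ) := by
  ext k
  rw [Finset.sum_apply]
  rcases lt_or_ge k n with hk | hk
  · rw [extendZero_of_lt x hk, Finset.sum_eq_single ⟨k, hk⟩]
    · simp
    · intro j _ hj
      have : k ≠ (j : ℕ) := fun h => hj (Fin.ext h.symm)
      simp [this]
    · simp
  · rw [extendZero_of_le x hk]
    refine (Finset.sum_eq_zero fun j _ => ?_).symm
    have : k ≠ (j : ℕ) := by omega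
    simp [this]

lemma hasSum_mul_extendZero (a : ℕ → ℝ) (x : Fin n → ℝ) :
    HasSum (fun j => a j * extendZero n x j) (∑ j : Fin n, a j * x j) := by
  have h : ∑ j : Fin n, a j * x j = ∑ j ∈ Finset.range n, a j * extendZero n x j := by
    rw [Finset.sum_range]
    simp
  rw [h]
  refine hasSum_sum_of_ne_finset_zero fun j hj => ?_
  rw [extendZero_of_le x (by simpa using hj), mul_zero]

end ExtendZero

/-! ### Bounded matrices between symmetric sequence spaces -/

namespace NormedSeqSpace

/-- `A` acts as a linear operator from `E` to `F` of norm at most `C`. -/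
def OperatorBound (E F : NormedSeqSpace) (A : Matrix ℕ ℕ ℝ) (C : ℝ) : Prop :=
  (∀ x : E.carrier, ∀ i : ℕ, Summable fun j : ℕ => A i j * (x : ℕ → ℝ) j) ∧
    ∀ x : E.carrier, ∃ h : (fun i : ℕ => ∑' j : ℕ, A i j * (x : ℕ → ℝ) j) ∈ F.carrier,
      F.norm ⟨_, h⟩ ≤ C * E.norm x

lemma OperatorBound.mono {E F : NormedSeqSpace} {A : Matrix ℕ ℕ ℝ} {C C' : ℝ}
    (h : OperatorBound E F A C) (hC : C ≤ C') : OperatorBound E F A C' :=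
  ⟨h.1, fun x => ⟨(h.2 x).1, (h.2 x).2.trans
    (mul_le_mul_of_nonneg_right hC (apply_nonneg _ _))⟩⟩

lemma mem_boundedMatrices_iff {E F : NormedSeqSpace} {A : Matrix ℕ ℕ ℝ} :
    A ∈ boundedMatrices E F ↔ ∃ C, 0 < C ∧ OperatorBound E F A C := by
  constructor
  · rintro ⟨h, C, hC⟩
    exact ⟨max C 1, by positivity, OperatorBound.mono ⟨h, hC⟩ (le_max_left _ _)⟩
  · rintro ⟨C, -, h⟩
    exact ⟨h.1, C, h.2⟩

lemma OperatorBound.smul {E F : NormedSeqSpace} {A : Matrix ℕ ℕ ℝ} {C : ℝ}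
    (h : OperatorBound E F A C) (c : ℝ) : OperatorBound E F (c • A) (|c| * C) := by
  have hrow : ∀ (x : E.carrier) (i : ℕ), (fun j => (c • A) i j * (x : ℕ → ℝ) j)
      = fun j => c * (A i j * (x : ℕ → ℝ) j) := fun x i => by
    ext j; simp [mul_assoc]
  refine ⟨fun x i => ?_, fun x => ?_⟩
  · rw [hrow]
    exact (h.1 x i).mul_left c
  · obtain ⟨hm, hb⟩ := h.2 x
    have heq : (fun i => ∑' j, (c • A) i j * (x : ℕ → ℝ) j)
        = c • fun i => ∑' j, A i j * (x : ℕ → ℝ) j := by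
      ext i
      rw [hrow, tsum_mul_left]
      rfl
    refine ⟨heq ▸ F.carrier.smul_mem c hm, ?_⟩
    have : F.norm (c • ⟨_, hm⟩) ≤ |c| * C * E.norm x := by
      rw [map_smul_eq_mul, Real.norm_eq_abs, mul_assoc]
      exact mul_le_mul_of_nonneg_left hb (abs_nonneg c)
    convert this using 3
    exact heq

namespace IsSymmetric

variable {E F : NormedSeqSpace}

/-- Solidity extracts one unit vector from a nonzero element; rearrangement invariance, through a
transposition of indices, moves it to every position. -/
lemma single_mem (hE : E.IsSymmetric) (j : ℕ) : (Pi.single j 1 : ℕ → ℝ) ∈ E.carrier := by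
  obtain ⟨x, hx⟩ := hE.nonzero
  obtain ⟨k, hk⟩ : ∃ k, (x : ℕ → ℝ) k ≠ 0 := by
    by_contra! h
    exact hx (Subtype.ext (funext h))
  obtain ⟨h1, -⟩ := hE.solid x (Pi.single k ((x : ℕ → ℝ) k)) fun i => by
    rcases eq_or_ne i k with rfl | h
    · simp
    · simp [h]
  have h2 : (Pi.single k 1 : ℕ → ℝ) ∈ E.carrier := by
    have := E.carrier.smul_mem ((x : ℕ → ℝ) k)⁻¹ h1
    rwa [← Pi.single_smul, smul_eq_mul, inv_mul_cancel₀ hk] at this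
  refine (hE.symmetric ⟨_, h2⟩ (Pi.single j 1) ⟨1, ?_⟩ ?_).1
  · rintro _ ⟨i, rfl⟩
    rcases eq_or_ne i j with rfl | h
    · simp
    · simp [h]
  · have hcard : ∀ t : ℝ, {i : ℕ | t < |(Pi.single j 1 : ℕ → ℝ) i|}.encard
        = {i : ℕ | t < |(Pi.single k 1 : ℕ → ℝ) i|}.encard := by
      intro t
      have : {i : ℕ | t < |(Pi.single j 1 : ℕ → ℝ) i|}
          = Equiv.swap j k '' {i : ℕ | t < |(Pi.single k 1 : ℕ → ℝ) i|} := by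
        rw [Equiv.image_eq_preimage_symm]
        ext i
        have : (Pi.single k 1 : ℕ → ℝ) (Equiv.swap j k i) = (Pi.single j 1 : ℕ → ℝ) i := by
          simp only [Pi.single_apply, Equiv.swap_apply_eq_iff, Equiv.swap_apply_right]
        simp [this]
      rw [this, (Equiv.swap j k).injective.encard_image]
    funext m
    simp only [decRearr, hcard]

/-- The norm of the unit vectors. -/
noncomputable def unitNorm (hE : E.IsSymmetric) (j : ℕ) : ℝ :=
  E.norm ⟨Pi.single j 1, hE.single_mem j⟩

lemma unitNorm_pos (hE : E.IsSymmetric) (j : ℕ) : 0 < hE.unitNorm j := by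
  refine lt_of_le_of_ne (apply_nonneg _ _) fun h => ?_
  have h1 := E.eq_zero_of_norm_eq_zero _ h.symm
  have h2 := congrFun (congrArg Subtype.val h1) j
  simp at h2

lemma abs_apply_le (hE : E.IsSymmetric) (x : E.carrier) (j : ℕ) :
    |(x : ℕ → ℝ) j| ≤ E.norm x / hE.unitNorm j := by
  rw [le_div_iff₀ (hE.unitNorm_pos j)]
  obtain ⟨h1, h2⟩ := hE.solid x (Pi.single j ((x : ℕ → ℝ) j)) fun i => by
    rcases eq_or_ne i j with rfl | h
    · simp
    · simp [h]
  refine le_trans (le_of_eq ?_) h2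
  have h3 : (⟨Pi.single j ((x : ℕ → ℝ) j), h1⟩ : E.carrier)
      = (x : ℕ → ℝ) j • ⟨Pi.single j 1, hE.single_mem j⟩ := by
    refine Subtype.ext ?_
    change _ = (x : ℕ → ℝ) j • (Pi.single j 1 : ℕ → ℝ)
    rw [← Pi.single_smul, smul_eq_mul, mul_one]
  rw [h3, map_smul_eq_mul, Real.norm_eq_abs, unitNorm]

lemma extendZero_mem (hE : E.IsSymmetric) {n : ℕ} (x : Fin n → ℝ) :
    extendZero n x ∈ E.carrier := by
  rw [extendZero_eq_sum]
  exact E.carrier.sum_mem fun i _ => E.carrier.smul_mem _ (hE.single_mem i)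

/-- The norm of `E` on sequences supported in the first `n` coordinates. -/
noncomputable def finSeminorm (hE : E.IsSymmetric) (n : ℕ) : Seminorm ℝ (Fin n → ℝ) :=
  E.norm.comp ((extendZero n).codRestrict E.carrier fun x => hE.extendZero_mem x)

lemma finSeminorm_apply (hE : E.IsSymmetric) {n : ℕ} (x : Fin n → ℝ) :
    hE.finSeminorm n x = E.norm ⟨extendZero n x, hE.extendZero_mem x⟩ := rfl

lemma norm_le_of_abs_le (hE : E.IsSymmetric) {x y : E.carrier}
    (h : ∀ k, |(x : ℕ → ℝ) k| ≤ |(y : ℕ → ℝ) k|) : E.norm x ≤ E.norm y :=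
  (hE.solid y x h).2

lemma finSeminorm_restrict_le (hE : E.IsSymmetric) {n : ℕ} (x : E.carrier) :
    hE.finSeminorm n (fun i => (x : ℕ → ℝ) i) ≤ E.norm x :=
  hE.norm_le_of_abs_le (abs_extendZero_le fun _ => le_rfl)

lemma isLatticeNorm (hE : E.IsSymmetric) (n : ℕ) : IsLatticeNorm (hE.finSeminorm n) where
  mono x y h := hE.norm_le_of_abs_le (abs_extendZero_le fun i => by simpa using h i)
  single_pos i := by
    refine lt_of_le_of_ne (apply_nonneg _ _) fun h => ?_
    have h1 := E.eq_zero_of_norm_eq_zero _ h.symm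
    have h2 := congrFun (congrArg Subtype.val h1) i
    simp at h2

lemma extendZero_finNorm {p : ℝ≥0∞} [Fact (1 ≤ p)] {m n : ℕ} (z : Fin m → Fin n → ℝ) :
    (fun i => finNorm p fun k => extendZero n (z k) i)
      = extendZero n fun i => finNorm p fun k => z k i := by
  ext i
  rcases lt_or_ge i n with hi | hi
  · simp only [extendZero_of_lt _ hi]
  · simp only [extendZero_of_le _ hi]
    exact finNorm_zero

lemma exists_isPConvexWith {p : ℝ≥0∞} [Fact (1 ≤ p)] (hE : E.IsSymmetric) (h : E.PConvex p) :
    ∃ C, 0 < C ∧ ∀ n, IsPConvexWith p C (hE.finSeminorm n) := by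
  obtain ⟨C, hC, h⟩ := h
  refine ⟨C, hC, fun n m z => ?_⟩
  obtain ⟨h1, h2⟩ := h m fun k => ⟨extendZero n (z k), hE.extendZero_mem _⟩
  refine le_trans (le_of_eq ?_) h2
  rw [finSeminorm_apply]
  congr 2
  exact (extendZero_finNorm z).symm

lemma exists_isQConcaveWith {q : ℝ≥0∞} [Fact (1 ≤ q)] (hE : E.IsSymmetric) (h : E.QConcave q) :
    ∃ C, 0 < C ∧ ∀ n, IsQConcaveWith q C (hE.finSeminorm n) := by
  obtain ⟨C, hC, h⟩ := h
  refine ⟨C, hC, fun n m z => ?_⟩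
  obtain ⟨h1, h2⟩ := h m fun k => ⟨extendZero n (z k), hE.extendZero_mem _⟩
  refine le_trans h2 (le_of_eq ?_)
  rw [finSeminorm_apply]
  congr 3
  exact extendZero_finNorm z

/-- Absolutely convergent series converge, and coordinatewise to the expected sum. -/
lemma exists_tsum (hF : F.IsSymmetric) {v : ℕ → F.carrier} (hv : Summable fun k => F.norm (v k)) :
    ∃ y : F.carrier, (∀ i, (y : ℕ → ℝ) i = ∑' k, (v k : ℕ → ℝ) i) ∧
      F.norm y ≤ ∑' k, F.norm (v k) := by
  set u : ℕ → F.carrier := fun m => ∑ k ∈ Finset.range m, v k with hu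
  have hcau := hv.hasSum.tendsto_sum_nat.cauchySeq
  have hdiff : ∀ m l, l ≤ m → F.norm (u m - u l) ≤
      ∑ k ∈ Finset.range m, F.norm (v k) - ∑ k ∈ Finset.range l, F.norm (v k) := by
    intro m l hlm
    simp only [hu]
    rw [← Finset.sum_Ico_eq_sub _ hlm, ← Finset.sum_Ico_eq_sub _ hlm]
    exact Finset.le_sum_of_subadditive F.norm (map_zero F.norm).le (map_add_le_add F.norm) _ _
  obtain ⟨y, hy⟩ := hF.complete u fun ε hε => by
    obtain ⟨K, hK⟩ := Metric.cauchySeq_iff.1 hcau ε hε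
    refine ⟨K, fun m hm l hl => ?_⟩
    rcases le_total l m with h | h
    · refine (hdiff m l h).trans_lt ((le_abs_self _).trans_lt ?_)
      simpa [Real.dist_eq] using hK m hm l hl
    · rw [map_sub_rev]
      refine (hdiff l m h).trans_lt ((le_abs_self _).trans_lt ?_)
      simpa [Real.dist_eq] using hK l hl m hm
  refine ⟨y, fun i => ?_, ?_⟩
  · have hsum : Summable fun k => (v k : ℕ → ℝ) i :=
      Summable.of_norm_bounded (hv.div_const _) fun k => hF.abs_apply_le (v k) i
    refine tendsto_nhds_unique ?_ hsum.hasSum.tendsto_sum_nat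
    rw [tendsto_iff_dist_tendsto_zero]
    refine squeeze_zero (fun _ => dist_nonneg) (fun m => ?_)
      (by simpa using hy.div_const (hF.unitNorm i))
    have := hF.abs_apply_le (u m - y) i
    simpa [Real.dist_eq, hu] using this
  · have hle : ∀ m, F.norm y ≤ ∑' k, F.norm (v k) + F.norm (u m - y) := by
      intro m
      have h1 : F.norm (u m) ≤ ∑' k, F.norm (v k) :=
        (Finset.le_sum_of_subadditive F.norm (map_zero F.norm).le (map_add_le_add F.norm) _ _).trans
          (hv.sum_le_tsum _ fun _ _ => apply_nonneg _ _)
      have h2 := map_sub_le_add F.norm (u m) (u m - y)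
      rw [sub_sub_cancel] at h2
      linarith
    have hlim := hy.const_add (∑' k, F.norm (v k))
    rw [add_zero] at hlim
    exact ge_of_tendsto' hlim hle

/-- Row sums of an operator are absolutely bounded. -/
lemma tsum_abs_row_le (hE : E.IsSymmetric) (hF : F.IsSymmetric) {A : Matrix ℕ ℕ ℝ} {C : ℝ}
    (hC : 0 ≤ C) (hA : OperatorBound E F A C) (x : E.carrier) (i : ℕ) :
    ∑' j, |A i j * (x : ℕ → ℝ) j| ≤ C * E.norm x / hF.unitNorm i := by
  have hsgn : ∀ t : ℝ, |(SignType.sign t : ℝ)| ≤ 1 := fun t => by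
    rcases lt_trichotomy t 0 with h | h | h <;> simp [h]
  -- Twisting x by the signs of the terms of row i turns the i-th coordinate of its image into the
  -- absolute row sum, and by solidity does not increase the norm.
  obtain ⟨h1, h2⟩ := hE.solid x
    (fun j => SignType.sign (A i j * (x : ℕ → ℝ) j) * (x : ℕ → ℝ) j) fun j => by
      rw [abs_mul]
      exact mul_le_of_le_one_left (abs_nonneg _) (hsgn _)
  obtain ⟨h3, h4⟩ := hA.2 ⟨_, h1⟩
  have h5 := hF.abs_apply_le ⟨_, h3⟩ i
  have h6 : ∑' j, |A i j * (x : ℕ → ℝ) j|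
      = ∑' j, A i j * (SignType.sign (A i j * (x : ℕ → ℝ) j) * (x : ℕ → ℝ) j) := by
    refine tsum_congr fun j => ?_
    rw [mul_left_comm, sign_mul_self]
  rw [h6]
  refine (le_abs_self _).trans (h5.trans (div_le_div_of_nonneg_right ?_ (hF.unitNorm_pos i).le))
  exact h4.trans (mul_le_mul_of_nonneg_left h2 hC)

lemma abs_entry_le (hE : E.IsSymmetric) (hF : F.IsSymmetric) {A : Matrix ℕ ℕ ℝ} {C : ℝ}
    (hC : 0 ≤ C) (hA : OperatorBound E F A C) (i j : ℕ) :
    |A i j| ≤ C * hE.unitNorm j / hF.unitNorm i := by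
  refine le_trans ?_ (hE.tsum_abs_row_le hF hC hA ⟨Pi.single j 1, hE.single_mem j⟩ i)
  rw [tsum_eq_single j fun k hk => by simp [hk]]
  simp

/-- `ℓ₁`-combinations of contractive matrices are bounded. -/
lemma operatorBound_tsum (hE : E.IsSymmetric) (hF : F.IsSymmetric) {A : ℕ → Matrix ℕ ℕ ℝ}
    (hA : ∀ k, OperatorBound E F (A k) 1) {t : ℕ → ℝ} (ht : Summable fun k => |t k|) :
    OperatorBound E F (Matrix.of fun i j => ∑' k, t k * A k i j) (∑' k, |t k|) := by
  -- Absolute row sums are bounded uniformly in k, so the double series over (k, j) converges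
  -- absolutely and the two summations may be interchanged.
  have hsum : ∀ (x : E.carrier) (i : ℕ),
      Summable fun kj : ℕ × ℕ => t kj.1 * A kj.1 i kj.2 * (x : ℕ → ℝ) kj.2 := by
    intro x i
    refine Summable.of_abs ?_
    have habs : ∀ k j, |t k * A k i j * (x : ℕ → ℝ) j| = |t k| * |A k i j * (x : ℕ → ℝ) j| :=
      fun k j => by rw [mul_assoc, abs_mul]
    refine (summable_prod_of_nonneg fun _ => abs_nonneg _).2 ⟨fun k => ?_, ?_⟩
    · simp only [habs]
      exact ((hA k).1 x i).abs.mul_left _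
    · simp only [habs, tsum_mul_left]
      refine Summable.of_nonneg_of_le
        (fun k => mul_nonneg (abs_nonneg _) (tsum_nonneg fun _ => abs_nonneg _)) (fun k => ?_)
        (ht.mul_right (1 * E.norm x / hF.unitNorm i))
      exact mul_le_mul_of_nonneg_left (hE.tsum_abs_row_le hF zero_le_one (hA k) x i) (abs_nonneg _)
  have hentry : ∀ (x : E.carrier) (i j : ℕ),
      (Matrix.of fun i j => ∑' k, t k * A k i j) i j * (x : ℕ → ℝ) j
        = ∑' k, t k * A k i j * (x : ℕ → ℝ) j := fun x i j => by
    rw [tsum_mul_right]; rfl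
  refine ⟨fun x i => ?_, fun x => ?_⟩
  · simp only [hentry]
    exact (hsum x i).prod_symm.prod
  · choose h1 h2 using fun k => (hA k).2 x
    have h3 : ∀ k, F.norm (t k • ⟨_, h1 k⟩) ≤ |t k| * E.norm x := fun k => by
      rw [map_smul_eq_mul, Real.norm_eq_abs]
      exact mul_le_mul_of_nonneg_left ((h2 k).trans_eq (one_mul _)) (abs_nonneg _)
    have hs : Summable fun k => F.norm (t k • ⟨_, h1 k⟩) :=
      Summable.of_nonneg_of_le (fun _ => apply_nonneg _ _) h3 (ht.mul_right _)
    -- The image of x is built as a norm-convergent series in F, then identified coordinatewise with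
    -- the action of the summed matrix.
    obtain ⟨y, hy, hyn⟩ := hF.exists_tsum hs
    have heq : (fun i => ∑' j, (Matrix.of fun i j => ∑' k, t k * A k i j) i j * (x : ℕ → ℝ) j)
        = (y : ℕ → ℝ) := by
      funext i
      rw [hy i]
      simp only [hentry]
      refine (Summable.tsum_comm (f := fun k j => t k * A k i j * (x : ℕ → ℝ) j) (hsum x i)).trans ?_
      refine tsum_congr fun k => ?_
      simp only [mul_assoc, tsum_mul_left]
      rfl
    refine ⟨heq ▸ y.2, ?_⟩
    have h4 : F.norm y ≤ (∑' k, |t k|) * E.norm x := by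
      refine hyn.trans ?_
      rw [← tsum_mul_right]
      exact hs.tsum_le_tsum h3 (ht.mul_right _)
    convert h4

end IsSymmetric

end NormedSeqSpace

/-! ### Uniform bounds for multipliers by Banach–Steinhaus -/

/-- A bounded sequence defines a continuous linear functional on `ℓ₁`. -/
lemma exists_l1_functional {a : ℕ → ℝ} {B : ℝ} (ha : ∀ k, |a k| ≤ B) :
    ∃ φ : lp (fun _ : ℕ => ℝ) 1 →L[ℝ] ℝ, ∀ t, φ t = ∑' k, t k * a k := by
  have habs : ∀ t : lp (fun _ : ℕ => ℝ) 1, Summable fun k => |t k| := fun t => by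
    simpa [Real.norm_eq_abs] using (lp.memℓp t).summable (by simp)
  have hle : ∀ (t : lp (fun _ : ℕ => ℝ) 1) k, ‖t k * a k‖ ≤ |t k| * B := fun t k => by
    rw [Real.norm_eq_abs, abs_mul]
    exact mul_le_mul_of_nonneg_left (ha k) (abs_nonneg _)
  have hs : ∀ t : lp (fun _ : ℕ => ℝ) 1, Summable fun k => t k * a k := fun t =>
    Summable.of_norm_bounded ((habs t).mul_right B) (hle t)
  refine ⟨LinearMap.mkContinuous
    { toFun := fun t => ∑' k, t k * a k
      map_add' := fun s t => by
        rw [← (hs s).tsum_add (hs t)]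
        exact tsum_congr fun k => by simp [add_mul]
      map_smul' := fun c t => by
        rw [RingHom.id_apply, smul_eq_mul, ← tsum_mul_left]
        exact tsum_congr fun k => by simp [mul_assoc] } B fun t => ?_, fun t => rfl⟩
  refine (tsum_of_norm_bounded ((habs t).mul_right B).hasSum (hle t)).trans (le_of_eq ?_)
  have hn : ‖t‖ = ∑' k, |t k| := by
    rw [lp.norm_eq_tsum_rpow (by simp)]
    simp [Real.norm_eq_abs]
  rw [tsum_mul_right, hn, mul_comm]

namespace NormedSeqSpace.IsSymmetric

variable {E F : NormedSeqSpace}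

/-- Uniform boundedness of a multiplier on contractive matrices, tested on finite sequences. -/
lemma exists_multiplier_bound_one (hE : E.IsSymmetric) (hF : F.IsSymmetric) {M : Matrix ℕ ℕ ℝ}
    (hM : M ∈ multipliers E F) :
    ∃ K : ℝ, ∀ (n : ℕ) (A : Matrix ℕ ℕ ℝ) (x y : Fin n → ℝ), OperatorBound E F A 1 →
      hE.finSeminorm n x ≤ 1 → (∀ z, |∑ i, y i * z i| ≤ hF.finSeminorm n z) →
      |∑ i : Fin n, y i * ∑ j : Fin n, M i j * A i j * x j| ≤ K := by
  by_contra! hcon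
  choose n A x y hA hx hy hlt using fun k : ℕ => hcon k
  choose φ hφ using fun i j : ℕ => exists_l1_functional (a := fun k => A k i j)
    (fun k => hE.abs_entry_le hF zero_le_one (hA k) i j)
  -- g k t is the bilinear form of M * Σ_l t_l A_l at (x_k, y_k). It involves finitely many entries,
  -- each a continuous functional of t.
  let g : ℕ → lp (fun _ : ℕ => ℝ) 1 →L[ℝ] ℝ := fun k =>
    ∑ i : Fin (n k), y k i • ∑ j : Fin (n k), (M i j * x k j) • φ i j
  have hg : ∀ k t, g k t = ∑ i : Fin (n k), y k i * ∑ j : Fin (n k), M i j * φ i j t * x k j := by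
    intro k t
    simp only [g, sum_apply, smul_apply, smul_eq_mul]
    refine Finset.sum_congr rfl fun i _ => ?_
    congr 1
    exact Finset.sum_congr rfl fun j _ => by ring
  -- For fixed t, the Schur product of M with Σ_l t_l A_l has some bound C, and this C serves all k
  -- at once.
  obtain ⟨K, hK⟩ := banach_steinhaus (g := g) fun t => by
    have ht : Summable fun k => |t k| := by
      simpa [Real.norm_eq_abs] using (lp.memℓp t).summable (by simp)
    have hAt := hE.operatorBound_tsum hF hA ht
    obtain ⟨C, hC, -, hMA⟩ := mem_boundedMatrices_iff.1
      (hM _ (mem_boundedMatrices_iff.2 ⟨_, by positivity, hAt.mono (le_add_of_nonneg_right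
        (zero_le_one' ℝ))⟩))
    refine ⟨C, fun k => ?_⟩
    obtain ⟨h1, h2⟩ := hMA ⟨extendZero _ (x k), hE.extendZero_mem _⟩
    have h3 := hF.finSeminorm_restrict_le (n := n k) ⟨_, h1⟩
    have h4 : ∀ i : Fin (n k), ∑' j, (Matrix.hadamard M
        (Matrix.of fun i j => ∑' k, t k * A k i j)) i j * extendZero _ (x k) j
        = ∑ j : Fin (n k), M i j * φ i j t * x k j := fun i => by
      rw [(hasSum_mul_extendZero _ _).tsum_eq]
      refine Finset.sum_congr rfl fun j _ => ?_
      rw [hφ]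
      rfl
    simp only [h4] at h3
    rw [Real.norm_eq_abs, hg]
    refine (hy k _).trans (h3.trans (h2.trans ?_))
    exact mul_le_of_le_one_right hC.le (hx k)
  obtain ⟨k, hk⟩ := exists_nat_gt K
  -- At the k-th unit vector of ℓ₁ the combination is A_k itself, so the form exceeds k > K in
  -- absolute value.
  have h1 := (g k).le_of_opNorm_le (hK k) (lp.single 1 k (1 : ℝ))
  rw [lp.norm_single (by simp), norm_one, mul_one, Real.norm_eq_abs, hg] at h1
  have h2 : ∀ i j : ℕ, φ i j (lp.single 1 k (1 : ℝ)) = A k i j := fun i j => by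
    rw [hφ, tsum_eq_single k fun l hl => by simp [hl]]
    simp
  simp only [h2] at h1
  linarith [hlt k]

/-- Homogeneous form of the uniform boundedness of a multiplier. -/
lemma exists_multiplier_bound (hE : E.IsSymmetric) (hF : F.IsSymmetric) {M : Matrix ℕ ℕ ℝ}
    (hM : M ∈ multipliers E F) :
    ∃ K : ℝ, ∀ (n : ℕ) (A : Matrix ℕ ℕ ℝ) (x y : Fin n → ℝ) (a b c : ℝ), 0 < a → 0 < b → 0 < c →
      OperatorBound E F A c → hE.finSeminorm n x ≤ a →
      (∀ z, |∑ i, y i * z i| ≤ b * hF.finSeminorm n z) →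
      |∑ i : Fin n, y i * ∑ j : Fin n, M i j * A i j * x j| ≤ K * (a * b * c) := by
  obtain ⟨K, hK⟩ := hE.exists_multiplier_bound_one hF hM
  refine ⟨K, fun n A x y a b c ha hb hc hA hx hy => ?_⟩
  have h := hK n (c⁻¹ • A) (a⁻¹ • x) (b⁻¹ • y) ?_ ?_ ?_
  · have h1 : ∑ i : Fin n, (b⁻¹ • y) i * ∑ j : Fin n, M i j * (c⁻¹ • A) i j * (a⁻¹ • x) j
        = (a * b * c)⁻¹ * ∑ i : Fin n, y i * ∑ j : Fin n, M i j * A i j * x j := by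
      simp only [Finset.mul_sum]
      refine Finset.sum_congr rfl fun i _ => Finset.sum_congr rfl fun j _ => ?_
      simp only [Pi.smul_apply, Matrix.smul_apply, smul_eq_mul, mul_inv]
      ring
    rw [h1, abs_mul, abs_of_pos (by positivity), inv_mul_le_iff₀ (by positivity)] at h
    linarith
  · have := hA.smul c⁻¹
    rwa [abs_of_pos (by positivity), inv_mul_cancel₀ hc.ne'] at this
  · rw [map_smul_eq_mul, Real.norm_of_nonneg (by positivity), inv_mul_le_iff₀ ha, mul_one]
    exact hx
  · intro z
    have h1 : ∑ i, (b⁻¹ • y) i * z i = b⁻¹ * ∑ i, y i * z i := by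
      simp [Finset.mul_sum, mul_assoc]
    rw [h1, abs_mul, abs_of_pos (by positivity), inv_mul_le_iff₀ hb]
    exact hy z

end NormedSeqSpace.IsSymmetric

/-! ### Operators from ℓ_p to ℓ_q through finite sections -/

namespace NormedSeqSpace

variable {p q : ℝ≥0∞} [Fact (1 ≤ p)] [Fact (1 ≤ q)]

lemma exists_ell_of_finNorm_le {z : ℕ → ℝ} {B : ℝ}
    (h : ∀ m, finNorm q (fun i : Fin m => z i) ≤ B) :
    ∃ hz : z ∈ (ell q).carrier, (ell q).norm ⟨z, hz⟩ ≤ B := by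
  have hB : 0 ≤ B := (finNorm_nonneg _).trans (h 0)
  by_cases hq : q = ∞
  · subst hq
    have hle : ∀ i, ‖z i‖ ≤ B := fun i =>
      (abs_le_finNorm (p := ∞) (fun k : Fin (i + 1) => z k) (Fin.last i)).trans (h (i + 1))
    have hz : Memℓp z ∞ := memℓp_infty ⟨B, by rintro _ ⟨i, rfl⟩; exact hle i⟩
    exact ⟨hz, lp.norm_le_of_forall_le (f := ⟨z, hz⟩) hB hle⟩
  · have h0 : 0 < q.toReal := ENNReal.toReal_pos (zero_lt_one.trans_le Fact.out).ne' hq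
    have hle : ∀ s : Finset ℕ, ∑ i ∈ s, ‖z i‖ ^ q.toReal ≤ B ^ q.toReal := fun s => by
      obtain ⟨m, hm⟩ := s.exists_nat_subset_range
      calc ∑ i ∈ s, ‖z i‖ ^ q.toReal ≤ ∑ i ∈ Finset.range m, ‖z i‖ ^ q.toReal :=
            Finset.sum_le_sum_of_subset_of_nonneg hm fun _ _ _ => by positivity
        _ = finNorm q (fun i : Fin m => z i) ^ q.toReal := by
            rw [finNorm_rpow hq, Finset.sum_range]
            rfl
        _ ≤ B ^ q.toReal := Real.rpow_le_rpow (finNorm_nonneg _) (h m) h0.le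
    have hz : Memℓp z q := memℓp_gen' hle
    exact ⟨hz, lp.norm_le_of_forall_sum_le (f := ⟨z, hz⟩) h0 hB hle⟩

lemma finNorm_restrict_le (x : (ell p).carrier) (n : ℕ) :
    finNorm p (fun i : Fin n => (x : ℕ → ℝ) i) ≤ (ell p).norm x := by
  have hn : (ell p).norm x = ‖(⟨x.1, x.2⟩ : lp (fun _ : ℕ => ℝ) p)‖ := rfl
  rw [hn]
  have hp0 : p ≠ 0 := (zero_lt_one.trans_le (Fact.out : 1 ≤ p)).ne'
  by_cases hp : p = ∞
  · subst hp
    exact finNorm_top_le (norm_nonneg _) fun i =>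
      lp.norm_apply_le_norm hp0 (⟨x.1, x.2⟩ : lp (fun _ : ℕ => ℝ) ∞) i
  · have h0 : 0 < p.toReal := ENNReal.toReal_pos hp0 hp
    have h := lp.sum_rpow_le_norm_rpow h0 (⟨x.1, x.2⟩ : lp (fun _ : ℕ => ℝ) p) (Finset.range n)
    rw [Finset.sum_range] at h
    refine (Real.rpow_le_rpow_iff (finNorm_nonneg _) (norm_nonneg _) h0).1 ?_
    rw [finNorm_rpow hp]
    exact h

lemma finNorm_extendZero_le {n : ℕ} (x : Fin n → ℝ) (m : ℕ) :
    finNorm p (fun i : Fin m => extendZero n x i) ≤ finNorm p x := by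
  by_cases hp : p = ∞
  · subst hp
    refine finNorm_top_le (finNorm_nonneg _) fun i => ?_
    rcases lt_or_ge (i : ℕ) n with hi | hi
    · rw [extendZero_of_lt x hi]
      exact abs_le_finNorm x _
    · rw [extendZero_of_le x hi, abs_zero]
      exact finNorm_nonneg _
  · have h0 : 0 < p.toReal :=
      ENNReal.toReal_pos (zero_lt_one.trans_le (Fact.out : 1 ≤ p)).ne' hp
    refine (Real.rpow_le_rpow_iff (finNorm_nonneg _) (finNorm_nonneg _) h0).1 ?_
    rw [finNorm_rpow hp, finNorm_rpow hp,
      ← Finset.sum_range fun i => |extendZero n x i| ^ p.toReal]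
    have h1 : ∑ i, |x i| ^ p.toReal
        = ∑ i ∈ Finset.range n, |extendZero n x i| ^ p.toReal := by
      rw [Finset.sum_range]
      simp
    rw [h1]
    rw [Finset.sum_subset (Finset.range_mono (le_max_right m n)) fun i _ hi => by
      rw [extendZero_of_le x (by simpa using hi), abs_zero, Real.zero_rpow h0.ne']]
    exact Finset.sum_le_sum_of_subset_of_nonneg (Finset.range_mono (le_max_left m n))
      fun _ _ _ => by positivity

lemma ell_extendZero {n : ℕ} (x : Fin n → ℝ) :
    ∃ h : extendZero n x ∈ (ell p).carrier, (ell p).norm ⟨_, h⟩ ≤ finNorm p x :=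
  exists_ell_of_finNorm_le (finNorm_extendZero_le x)

lemma finNorm_restrict_mono (z : ℕ → ℝ) {m n : ℕ} (h : m ≤ n) :
    finNorm q (fun i : Fin m => z i) ≤ finNorm q (fun i : Fin n => z i) := by
  refine le_trans (le_of_eq ?_) (finNorm_extendZero_le (fun i : Fin n => z i) m)
  congr 1
  ext i
  rw [extendZero_of_lt _ (i.2.trans_le h)]

/-- A matrix whose finite sections are uniformly bounded from `ℓ_p` to `ℓ_q` is bounded. -/
lemma operatorBound_ell_of_finNorm {T : Matrix ℕ ℕ ℝ} {K : ℝ} (hK : 0 ≤ K)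
    (hT : ∀ (n : ℕ) (x : Fin n → ℝ),
      finNorm q (fun i : Fin n => ∑ j : Fin n, T i j * x j) ≤ K * finNorm p x) :
    OperatorBound (ell p) (ell q) T K := by
  have hsgn : ∀ t : ℝ, |(SignType.sign t : ℝ)| ≤ 1 := fun t => by
    rcases lt_trichotomy t 0 with h | h | h <;> simp [h]
  have hsum : ∀ (x : (ell p).carrier) (i : ℕ), Summable fun j => T i j * (x : ℕ → ℝ) j := by
    intro x i
    refine Summable.of_abs (summable_of_sum_range_le (c := K * (ell p).norm x)
      (fun _ => abs_nonneg _) fun n => ?_)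
    -- The square section has to be enlarged so that it contains row i.
    have hi : i < max n (i + 1) := by omega
    calc ∑ j ∈ Finset.range n, |T i j * (x : ℕ → ℝ) j|
        ≤ ∑ j ∈ Finset.range (max n (i + 1)), |T i j * (x : ℕ → ℝ) j| :=
          Finset.sum_le_sum_of_subset_of_nonneg (by simp) fun _ _ _ => abs_nonneg _
      _ = ∑ j : Fin (max n (i + 1)), T i j *
            (SignType.sign (T i j * (x : ℕ → ℝ) j) * (x : ℕ → ℝ) j) := by
          rw [Finset.sum_range]
          exact Finset.sum_congr rfl fun j _ => by rw [mul_left_comm, sign_mul_self]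
      _ ≤ finNorm q fun i' : Fin (max n (i + 1)) => ∑ j : Fin (max n (i + 1)), T i' j *
            (SignType.sign (T i j * (x : ℕ → ℝ) j) * (x : ℕ → ℝ) j) :=
          (le_abs_self _).trans (abs_le_finNorm (p := q) (fun i' : Fin (max n (i + 1)) =>
            ∑ j : Fin (max n (i + 1)), T i' j *
              (SignType.sign (T i j * (x : ℕ → ℝ) j) * (x : ℕ → ℝ) j)) ⟨i, hi⟩)
      _ ≤ K * finNorm p fun j : Fin (max n (i + 1)) =>
            SignType.sign (T i j * (x : ℕ → ℝ) j) * (x : ℕ → ℝ) j := hT _ _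
      _ ≤ K * (ell p).norm x := by
          refine mul_le_mul_of_nonneg_left ((finNorm_mono fun j => ?_).trans
            (finNorm_restrict_le x _)) hK
          rw [abs_mul]
          exact mul_le_of_le_one_left (abs_nonneg _) (hsgn _)
  refine ⟨hsum, fun x => exists_ell_of_finNorm_le fun m => ?_⟩
  -- Only m rows are observed, so the columns may be truncated at n and the limit taken; for n ≥ m
  -- the bound for the n × n section applies.
  have hlim : Filter.Tendsto
      (fun n => finNorm q fun i : Fin m => ∑ j ∈ Finset.range n, T i j * (x : ℕ → ℝ) j)
      Filter.atTop (nhds (finNorm q fun i : Fin m => ∑' j, T i j * (x : ℕ → ℝ) j)) :=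
    (continuous_finNorm.tendsto _).comp
      (tendsto_pi_nhds.2 fun i => (hsum x i).hasSum.tendsto_sum_nat)
  refine le_of_tendsto hlim ?_
  filter_upwards [Filter.eventually_ge_atTop m] with n hn
  refine (finNorm_restrict_mono (fun i => ∑ j ∈ Finset.range n, T i j * (x : ℕ → ℝ) j) hn).trans ?_
  simp only [Finset.sum_range]
  exact (hT n fun j => (x : ℕ → ℝ) j).trans
    (mul_le_mul_of_nonneg_left (finNorm_restrict_le x n) hK)

end NormedSeqSpace

/-! ### Transfer of multipliers -/

namespace NormedSeqSpace

variable {p q : ℝ≥0∞} [Fact (1 ≤ p)] [Fact (1 ≤ q)] {E F : NormedSeqSpace}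

/-- Sandwiching a matrix bounded from `ℓ_p` to `ℓ_q` between finitely supported diagonal
contractions `E → ℓ_p` and `ℓ_q → F` gives a matrix bounded from `E` to `F`. -/
lemma IsSymmetric.operatorBound_sandwich (hE : E.IsSymmetric) (hF : F.IsSymmetric)
    {A : Matrix ℕ ℕ ℝ} {c : ℝ} (hc : 0 ≤ c) (hA : OperatorBound (ell p) (ell q) A c) {n : ℕ}
    {d g : Fin n → ℝ} (hd : ∀ z, finNorm p (fun i => d i * z i) ≤ hE.finSeminorm n z)
    (hg : ∀ z, hF.finSeminorm n (fun i => g i * z i) ≤ finNorm q z) :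
    OperatorBound E F (Matrix.of fun i j => extendZero n g i * A i j * extendZero n d j) c := by
  have hrow : ∀ (x : ℕ → ℝ) (i : ℕ), HasSum
      (fun j => (Matrix.of fun i j => extendZero n g i * A i j * extendZero n d j) i j * x j)
      (extendZero n g i * ∑ j : Fin n, A i j * (d j * x j)) := by
    intro x i
    refine ((hasSum_mul_extendZero (A i) fun j => d j * x j).mul_left
      (extendZero n g i)).congr_fun fun j => ?_
    rcases lt_or_ge j n with hj | hj
    · rw [extendZero_of_lt _ hj, Matrix.of_apply, extendZero_of_lt d hj]
      ring
    · rw [extendZero_of_le _ hj, Matrix.of_apply, extendZero_of_le d hj]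
      ring
  refine ⟨fun x i => (hrow x i).summable, fun x => ?_⟩
  have heq : (fun i => ∑' j, (Matrix.of fun i j =>
        extendZero n g i * A i j * extendZero n d j) i j * (x : ℕ → ℝ) j)
      = extendZero n fun i => g i * ∑ j : Fin n, A i j * (d j * (x : ℕ → ℝ) j) := by
    funext i
    rw [(hrow x i).tsum_eq]
    rcases lt_or_ge i n with hi | hi
    · rw [extendZero_of_lt _ hi, extendZero_of_lt _ hi]
    · rw [extendZero_of_le _ hi, extendZero_of_le _ hi, zero_mul]
  refine ⟨heq ▸ hF.extendZero_mem _, ?_⟩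
  obtain ⟨h1, h2⟩ := ell_extendZero (p := p) fun j : Fin n => d j * (x : ℕ → ℝ) j
  obtain ⟨h3, h4⟩ := hA.2 ⟨_, h1⟩
  have h5 := finNorm_restrict_le ⟨_, h3⟩ n
  simp only [(hasSum_mul_extendZero _ _).tsum_eq] at h5
  have h6 : hF.finSeminorm n (fun i => g i * ∑ j : Fin n, A i j * (d j * (x : ℕ → ℝ) j))
      ≤ c * E.norm x := by
    refine (hg _).trans (h5.trans ((le_of_eq ?_).trans (h4.trans
      (mul_le_mul_of_nonneg_left (h2.trans ((hd _).trans (hE.finSeminorm_restrict_le x))) hc))))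
    congr 2
    funext i
    exact (hasSum_mul_extendZero _ _).tsum_eq.symm
  rw [IsSymmetric.finSeminorm_apply] at h6
  convert h6

lemma multipliers_subset_ell {q' : ℝ≥0∞} [Fact (1 ≤ q')] [q.HolderConjugate q']
    (hE : E.IsSymmetric) (hF : F.IsSymmetric) (hEp : E.PConvex p) (hFq : F.QConcave q) :
    multipliers E F ⊆ multipliers (ell p) (ell q) := by
  intro M hM A hA
  obtain ⟨c, hc, hA⟩ := mem_boundedMatrices_iff.1 hA
  obtain ⟨K, hK⟩ := hE.exists_multiplier_bound hF hM
  obtain ⟨CE, hCE, hEconv⟩ := hE.exists_isPConvexWith hEp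
  obtain ⟨CF, hCF, hFconc⟩ := hF.exists_isQConcaveWith hFq
  have hbil : ∀ (n : ℕ) (x y : Fin n → ℝ),
      |∑ i : Fin n, y i * ∑ j : Fin n, M i j * A i j * x j|
        ≤ K * (CE * finNorm p x * (CF * finNorm q' y) * c) := by
    intro n x y
    -- Zero vectors are treated apart because the homogeneous multiplier bound requires strictly
    -- positive constants.
    rcases (finNorm_nonneg (p := p) x).eq_or_lt with hx | hx
    · simp [finNorm_eq_zero.1 hx.symm, finNorm_zero]
    rcases (finNorm_nonneg (p := q') y).eq_or_lt with hy | hy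
    · simp [finNorm_eq_zero.1 hy.symm, finNorm_zero]
    obtain ⟨d, e, hde, he, hd⟩ := (hE.isLatticeNorm n).exists_factorization hCE.le (hEconv n) x
    obtain ⟨g, f, hgf, hf, hg⟩ :=
      (hF.isLatticeNorm n).exists_dual_factorization (p := q') hCF.le (hFconc n) y
    -- The multiplier is tested on D_g A D_d at (e, f). Moving d and g back onto the vectors turns
    -- this into the form of M * A at (x, y).
    have h := hK n _ e f _ _ c (mul_pos hCE hx) (mul_pos hCF hy) hc
      (hE.operatorBound_sandwich hF hc.le hA hd hg) he hf
    refine le_trans (le_of_eq ?_) h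
    congr 1
    refine Finset.sum_congr rfl fun i _ => ?_
    rw [← hgf i, mul_comm (g i), mul_assoc, Finset.mul_sum]
    congr 1
    refine Finset.sum_congr rfl fun j _ => ?_
    rw [← hde j, Matrix.of_apply, extendZero_val, extendZero_val]
    ring
  have hfin : ∀ (n : ℕ) (x : Fin n → ℝ),
      finNorm q (fun i : Fin n => ∑ j : Fin n, Matrix.hadamard M A i j * x j)
        ≤ |K * (CE * CF * c)| * finNorm p x := by
    intro n x
    obtain ⟨y, hy, hyx⟩ := exists_sum_mul_eq_finNorm (p := q) (q := q')
      (fun i : Fin n => ∑ j : Fin n, Matrix.hadamard M A i j * x j)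
    rw [← hyx]
    calc ∑ i : Fin n, (∑ j : Fin n, Matrix.hadamard M A i j * x j) * y i
        ≤ |∑ i : Fin n, y i * ∑ j : Fin n, M i j * A i j * x j| := by
          simp only [mul_comm (y _)]
          exact le_abs_self _
      _ ≤ K * (CE * finNorm p x * (CF * finNorm q' y) * c) := hbil n x y
      _ = K * (CE * CF * c) * (finNorm p x * finNorm q' y) := by ring
      _ ≤ |K * (CE * CF * c)| * (finNorm p x * finNorm q' y) :=
          mul_le_mul_of_nonneg_right (le_abs_self _)
            (mul_nonneg (finNorm_nonneg _) (finNorm_nonneg _))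
      _ ≤ |K * (CE * CF * c)| * finNorm p x :=
          mul_le_mul_of_nonneg_left (mul_le_of_le_one_right (finNorm_nonneg _) hy) (abs_nonneg _)
  exact mem_boundedMatrices_iff.2 ⟨_, by positivity,
    (operatorBound_ell_of_finNorm (abs_nonneg _) hfin).mono
      (le_add_of_nonneg_right (zero_le_one' ℝ))⟩

end NormedSeqSpace

theorem theorem4 (p q : ℝ≥0∞) [Fact (1 ≤ p)] [Fact (1 ≤ q)] (E F : NormedSeqSpace)
    (hE : E.IsSymmetric) (hF : F.IsSymmetric) (hEp : E.PConvex p) (hFq : F.QConcave q) :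
    NormedSeqSpace.multipliers E F ⊆
      NormedSeqSpace.multipliers (NormedSeqSpace.ell p) (NormedSeqSpace.ell q) := by
  -- Inversion in `ℝ≥0∞` covers the endpoints: the conjugate is ∞ for q = 1 and 1 for q = ∞.
  have hq : q.HolderConjugate (1 - q⁻¹)⁻¹ := by
    rw [ENNReal.holderConjugate_iff, inv_inv]
    exact add_tsub_cancel_of_le (ENNReal.inv_le_one.2 Fact.out)
  have : Fact (1 ≤ (1 - q⁻¹)⁻¹) := ⟨ENNReal.HolderConjugate.one_le _ q⟩
  exact NormedSeqSpace.multipliers_subset_ell (q' := (1 - q⁻¹)⁻¹) hE hF hEp hFq
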